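/- **Setting.** Let $\mathcal A$ be a finite alphabet and let $\Phi:\mathcal A^{\mathbb Z}\to\mathcal A^{\mathbb Z}$ be the nearest-neighbour cellular automaton $\Phi(\mathbf a)_z=\phi(a_{z-1},a_z,a_{z+1})$ with local rule $\phi:\mathcal A^3\to\mathcal A$. For a shift-invariant $\mathbf S\subseteq\mathcal A^{\mathbb Z}$ let $\mathbf S_n$ be the set of words of length $n$ occurring in $\mathbf S$. $\mathbf S$ is a *Markov subshift* if $\mathbf S=\{\mathbf s:(s_z,s_{z+1})\in\mathbf S_2\ \forall z\}$. Put $\mathcal P_{\mathbf S}(b)=\{a:(a,b)\in\mathbf S_2\}$ and $\mathcal F_{\mathbf S}(b)=\{c:(b,c)\in\mathbf S_2\}$. $\mathbf S$ is *left-regular* (*right-regular*) if $\#\mathcal P_{\mathbf S}(b)$ (resp. $\#\mathcal F_{\mathbf S}(b)$) is the same for all $b\in\mathbf S_1$. It is *left-resolving* for $\Phi$ if for all $(b,c,d)\in\mathbf S_3$ the map $a\mapsto\phi(a,b,c)$ is an injection $\mathcal P_{\mathbf S}(b)\to\mathcal P_{\mathbf S}(\phi(b,c,d))$, and *right-resolving*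 if for all $(a,b,c)\in\mathbf S_3$ the map $d\mapsto\phi(b,c,d)$ is an injection $\mathcal F_{\mathbf S}(c)\to\mathcal F_{\mathbf S}(\phi(a,b,c))$. A *Parry measure* on $\mathbf S$ is a measure of maximal entropy: a shift-invariant probability measure on $\mathbf S$ whose entropy equals the topological entropy of $\mathbf S$. A *resolving system* for $\Phi$ is a quadruple $(\mathbf L,\mathbf R;\lambda,\rho)$ such that $\mathbf L$, $\mathbf R$ and $\mathbf S:=\mathbf L\cup\mathbf R$ are Markov subshifts; $\Phi(\mathbf L)\subseteq\mathbf L$ and $\mathbf L$ is left-regular and left-resolving for $\Phi$; $\Phi(\mathbf R)\subseteq\mathbf R$ and $\mathbf R$ is right-regular and right-resolving for $\Phi$; $\lambda$ and $\rho$ are Parry measures on $\mathbf L$ and $\mathbf R$. For $W\in\mathbb N$ put $L=\lceil W/2\rceil-1$ and $R=\lfloor W/2\rfloor$, so $W=L+R+1$. A sequence $\mathbf a$ has an *$(\mathbf L,\mathbf R)$-defect of width at most $W$* if there are a first index $i$ and a last index $k$ with $(a_i,a_{i+1})\notin\mathbf S_2$ and $(a_k,a_{k+1})\notin\mathbf S_2$,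 if $k-i\le W$, and if, with $z:=i+\lceil (k-i)/2\rceil$ (the *location* of the defect), $\mathbf a$ agrees with an element of $\mathbf L$ on $(-\infty,z-L-1]$ and with an element of $\mathbf R$ on $[z+R+1,\infty)$. $\mathbf a$ has a *defect particle of width $W$* if every $\Phi^t(\mathbf a)$, $t\ge 0$, has an $(\mathbf L,\mathbf R)$-defect of width at most $W$; $z_t=z_t(\mathbf a)$ is then its location in $\Phi^t(\mathbf a)$. For a probability measure $\delta$ on $\mathcal A^W$ let $\mu=\lambda\otimes\delta\otimes\rho$ be the law on $\mathcal A^{\mathbb Z}$ of $[\ldots l_{-2}\,l_{-1}\;d_{-L}\ldots d_R\;r_1\,r_2\ldots]$, where $\mathbf d=(d_{-L},\dots,d_R)$ occupies the positions $-L,\dots,R$ and $\mathbf l\sim\lambda$, $\mathbf d\sim\delta$, $\mathbf r\sim\rho$ are independent. A measure on $X^{\mathbb N}$, $X$ finite, is a *Markov measure* if it is the law of a time-homogeneous Markov chain (with any initial law). A *hidden Markov measure* is the image of a Markov measure over a finite set $X$ under coordinatewise application of a function on $X$. A *generalized random walk* is the law of $(0,v_1,v_1+v_2,\ldots)$ where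 the law of the increments $(v_1,v_2,\ldots)\in\mathbb Z^{\mathbb N}$ is a hidden Markov measure. **Theorem 3.1.** Let $(\mathbf L,\mathbf R;\lambda,\rho)$ be a resolving system for $\Phi$, let $W\in\mathbb N$, and let $\delta$ be any probability measure on $\mathcal A^W$ such that $\mu=\lambda\otimes\delta\otimes\rho$ is concentrated on the configurations that have an $(\mathbf L,\mathbf R)$-defect particle of width $W$. Then: 1. If the particle starts at zero, i.e. $z_0=0$ $\mu$-almost surely, the law of the defect trajectory $(z_0,z_1,z_2,\ldots)$ under $\mu$ is a generalized random walk. 2. In any case, the law of $(z_t-z_0)_{t\ge0}$ under $\mu$ is a generalized random walk; that is, the increments $z_{t+1}-z_t$ form a hidden Markov process. 3. Let $y_0=z_0$ and $y_{t+1}=y_t+\operatorname{sign}(z_{t+1}-y_t)$ (so $y_t=z_t$ whenever the particle never moves by more than one cell per time step). For every $K\ge W+3$ the local state sequence $\xi_t=\big(\Phi^t(\mathbf a)_{y_t+j}\big)_{-K\le j\le K}$ is, under $\mu$, a Markov chain with finite state space $\mathcal A^{2K+1}$, and there is a function $v:\mathcal A^{2K+1}\to\mathbb Z$ such that, $\mu$-almost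 surely, $z_{t+1}-z_t=v(\xi_t)$ for all $t\in\mathbb N$. -/

import Mathlib

open MeasureTheory

namespace DefectCA

noncomputable section

/-! ### Shifts, subshifts and cellular automata -/

/-- The shift map on bi-infinite sequences. -/
def shift {A : Type*} (a : ℤ → A) : ℤ → A := fun z => a (z + 1)

/-- The nearest-neighbour cellular automaton with local rule `φ`. -/
def caMap {A : Type*} (φ : A → A → A → A) (a : ℤ → A) : ℤ → A :=
  fun z => φ (a (z - 1)) (a z) (a (z + 1))

/-- The set of admissible `n`-words of `S`. -/
def words {A : Type*} (S : Set (ℤ → A)) (n : ℕ) : Set (Fin n → A) :=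
  {w | ∃ s ∈ S, ∀ i : Fin n, s (i : ℕ) = w i}

/-- `(a, b)` is an admissible transition of `S`. -/
def Adm {A : Type*} (S : Set (ℤ → A)) (a b : A) : Prop := ![a, b] ∈ words S 2

/-- `S` is a Markov subshift: the set of all bi-infinite paths along its own admissible
transitions (for a finite alphabet such a set is automatically closed and shift-invariant). -/
def IsMarkovSubshift {A : Type*} (S : Set (ℤ → A)) : Prop :=
  ∀ s : ℤ → A, s ∈ S ↔ ∀ z : ℤ, Adm S (s z) (s (z + 1))

/-- The symbols that occur in `S`. -/
def symbols {A : Type*} (S : Set (ℤ → A)) : Set A := {b | ∃ s ∈ S, s 0 = b}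

/-- Predecessor set of a symbol. -/
def pred {A : Type*} (S : Set (ℤ → A)) (b : A) : Set A := {a | Adm S a b}

/-- Follower set of a symbol. -/
def follow {A : Type*} (S : Set (ℤ → A)) (b : A) : Set A := {c | Adm S b c}

def LeftRegular {A : Type*} (S : Set (ℤ → A)) : Prop :=
  ∃ P : ℕ, ∀ b ∈ symbols S, (pred S b).ncard = P

def RightRegular {A : Type*} (S : Set (ℤ → A)) : Prop :=
  ∃ F : ℕ, ∀ b ∈ symbols S, (follow S b).ncard = F

/-- For every admissible `(b, c, d)` the map `a ↦ φ(a, b, c)` is an injection from the predecessors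
of `b` to the predecessors of `φ(b, c, d)`. -/
def LeftResolving {A : Type*} (φ : A → A → A → A) (S : Set (ℤ → A)) : Prop :=
  ∀ b c d : A, ![b, c, d] ∈ words S 3 →
    Set.MapsTo (fun a => φ a b c) (pred S b) (pred S (φ b c d)) ∧
      Set.InjOn (fun a => φ a b c) (pred S b)

/-- For every admissible `(a, b, c)` the map `d ↦ φ(b, c, d)` is an injection from the followers
of `c` to the followers of `φ(a, b, c)`. -/
def RightResolving {A : Type*} (φ : A → A → A → A) (S : Set (ℤ → A)) : Prop :=
  ∀ a b c : A, ![a, b, c] ∈ words S 3 →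
    Set.MapsTo (fun d => φ b c d) (follow S c) (follow S (φ a b c)) ∧
      Set.InjOn (fun d => φ b c d) (follow S c)

/-! ### Entropy and Parry measures -/

/-- Shannon entropy of the distribution of `(x₀, …, x_{n-1})` under `η`. -/
def blockEntropy {A : Type*} [Fintype A] [MeasurableSpace A] (η : Measure (ℤ → A)) (n : ℕ) : ℝ :=
  ∑ w : Fin n → A, Real.negMulLog (η.real {x | ∀ i : Fin n, x (i : ℕ) = w i})

/-- `η` has shift-entropy `h`. -/
def HasEntropy {A : Type*} [Fintype A] [MeasurableSpace A] (η : Measure (ℤ → A)) (h : ℝ) : Prop :=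
  Filter.Tendsto (fun n : ℕ => blockEntropy η n / n) Filter.atTop (nhds h)

/-- `S` has topological entropy `h`. -/
def HasTopEntropy {A : Type*} (S : Set (ℤ → A)) (h : ℝ) : Prop :=
  Filter.Tendsto (fun n : ℕ => Real.log ((words S n).ncard : ℝ) / n) Filter.atTop (nhds h)

/-- `η` is a measure of maximal entropy (Parry measure) on `S`: a shift-invariant probability
measure carried by `S` whose entropy equals the topological entropy of `S`. -/
structure IsParryMeasure {A : Type*} [Fintype A] [MeasurableSpace A]
    (S : Set (ℤ → A)) (η : Measure (ℤ → A)) : Prop where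
  prob : IsProbabilityMeasure η
  carried : ∀ᵐ x ∂η, x ∈ S
  invariant : MeasurePreserving shift η η
  maximal : ∃ h : ℝ, HasEntropy η h ∧ HasTopEntropy S h

/-- Resolving systems `(L, R; lam, rho)` for the cellular automaton with local rule `φ`. -/
structure IsResolvingSystem {A : Type*} [Fintype A] [MeasurableSpace A] (φ : A → A → A → A)
    (L R : Set (ℤ → A)) (lam rho : Measure (ℤ → A)) : Prop where
  markov_left : IsMarkovSubshift L
  markov_right : IsMarkovSubshift R
  markov_union : IsMarkovSubshift (L ∪ R)
  left_regular : LeftRegular L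
  left_invariant : Set.MapsTo (caMap φ) L L
  left_resolving : LeftResolving φ L
  right_regular : RightRegular R
  right_invariant : Set.MapsTo (caMap φ) R R
  right_resolving : RightResolving φ R
  left_parry : IsParryMeasure L lam
  right_parry : IsParryMeasure R rho

/-! ### Defect particles -/

/-- The positions `j` of the inadmissible transitions `(a_j, a_{j+1})` of `a`. -/
def badSet {A : Type*} (S : Set (ℤ → A)) (a : ℤ → A) : Set ℤ := {j | ¬ Adm S (a j) (a (j + 1))}

/-- The location `⌈(i + k) / 2⌉` of a defect whose first and last inadmissible transitions are at
`i` and `k`; equivalently `i + ⌈w / 2⌉` where `w = k - i` is the width. -/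
def centre {A : Type*} (S : Set (ℤ → A)) (a : ℤ → A) : ℤ :=
  (sInf (badSet S a) + sSup (badSet S a) + 1) / 2

/-- `⌈W / 2⌉ - 1`, the left extent of a window of width `W`. -/
def extL (W : ℕ) : ℤ := ((W : ℤ) + 1) / 2 - 1

/-- `⌊W / 2⌋`, the right extent of a window of width `W`. -/
def extR (W : ℕ) : ℤ := (W : ℤ) / 2

/-- `a` has an `(L, R)`-defect of width at most `W`: inadmissible transitions exist, they spread
over a distance at most `W`, and, `z` being the location of the defect, the part of `a` to the left
of the window `[z - extL W, z + extR W]` is `L`-admissible, the part to its right `R`-admissible. -/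
def HasDefect {A : Type*} (L R : Set (ℤ → A)) (W : ℕ) (a : ℤ → A) : Prop :=
  (∃ i k : ℤ, IsLeast (badSet (L ∪ R) a) i ∧ IsGreatest (badSet (L ∪ R) a) k ∧ k - i ≤ W) ∧
  (∃ l ∈ L, ∀ j : ℤ, j < centre (L ∪ R) a - extL W → l j = a j) ∧
  (∃ r ∈ R, ∀ j : ℤ, centre (L ∪ R) a + extR W < j → r j = a j)

/-- Configurations with an `(L, R)`-defect particle of width `W`: the defect persists forever and
its width never exceeds `W`. -/
def particles {A : Type*} (φ : A → A → A → A) (L R : Set (ℤ → A)) (W : ℕ) : Set (ℤ → A) :=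
  {a | ∀ t : ℕ, HasDefect L R W ((caMap φ)^[t] a)}

/-- The defect trajectory `(z₀, z₁, z₂, …)`. -/
def trajectory {A : Type*} (φ : A → A → A → A) (S : Set (ℤ → A)) (a : ℤ → A) : ℕ → ℤ :=
  fun t => centre S ((caMap φ)^[t] a)

/-- The configuration `… l₋₂ l₋₁ d₀ … d_{W-1} r₁ r₂ …`, the word `d` occupying the window
`[-extL W, extR W]`. -/
def glue {A : Type*} (W : ℕ) (x : (ℤ → A) × (Fin W → A) × (ℤ → A)) : ℤ → A := fun j =>
  if h : j < -extL W then x.1 (j + extL W)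
  else if h' : extR W < j then x.2.2 (j - extR W)
  else x.2.1 ⟨(j + extL W).toNat, by unfold extL extR at *; omega⟩

/-- The measure `lam ⊗ del ⊗ rho`. -/
def initialMeasure {A : Type*} [MeasurableSpace A] (W : ℕ) (lam : Measure (ℤ → A))
    (del : Measure (Fin W → A)) (rho : Measure (ℤ → A)) : Measure (ℤ → A) :=
  (lam.prod (del.prod rho)).map (glue W)

/-- The unit-speed follower of an integer sequence: it starts at `z₀` and at each time moves by at
most one step towards the current position. If `z` itself never moves by more than one step, then
`follower z = z`. -/
def follower (z : ℕ → ℤ) : ℕ → ℤ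
  | 0 => z 0
  | t + 1 => follower z t + (z (t + 1) - follower z t).sign

/-- The local state of the particle at time `t`: the pattern of `Φᵗ(a)` within distance `K` of the
unit-speed follower of the defect. -/
def localState {A : Type*} (φ : A → A → A → A) (S : Set (ℤ → A)) (K : ℕ) (a : ℤ → A) (t : ℕ) :
    Set.Icc (-(K : ℤ)) K → A :=
  fun j => (caMap φ)^[t] a (follower (trajectory φ S a) t + j)

/-! ### Markov measures and random walks -/

/-- `m` is a (time-homogeneous, not necessarily stationary) Markov measure on `X^ℕ`, with some
initial law `p` and transition probabilities `τ`. -/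
def IsMarkovMeasure {X : Type*} [MeasurableSpace X] (m : Measure (ℕ → X)) : Prop :=
  ∃ (p : PMF X) (τ : X → PMF X), ∀ (n : ℕ) (c : ℕ → X),
    m {x | ∀ i ≤ n, x i = c i} = p (c 0) * ∏ i ∈ Finset.range n, τ (c i) (c (i + 1))

/-- A hidden Markov measure: the image of a finite-state Markov measure under a map of states.
(Finiteness is essential: over a countable state space every process would qualify.) -/
def IsHiddenMarkov (ν : Measure (ℕ → ℤ)) : Prop :=
  ∃ (n : ℕ) (m : Measure (ℕ → Fin n)) (ψ : Fin n → ℤ),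
    IsMarkovMeasure m ∧ ν = m.map (fun x t => ψ (x t))

/-- Partial sums `(0, v₀, v₀ + v₁, …)`. -/
def partialSums (v : ℕ → ℤ) : ℕ → ℤ := fun n => ∑ i ∈ Finset.range n, v i

/-- A generalized random walk: the law of the partial sums of a hidden Markov process. -/
def IsRandomWalk (ω : Measure (ℕ → ℤ)) : Prop :=
  ∃ ν : Measure (ℕ → ℤ), IsHiddenMarkov ν ∧ ω = ν.map partialSums

end

end DefectCA

namespace DefectCA

set_option linter.unusedSectionVars false

noncomputable section

/-! ### Consistent families of word weights of maximal entropy -/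

lemma sum_words_cons {A : Type*} [Fintype A] {M : Type*} [AddCommMonoid M] {n : ℕ}
    (f : (Fin (n + 1) → A) → M) :
    ∑ w, f w = ∑ w : Fin n → A, ∑ b, f (Fin.cons b w) := by
  rw [← (Fin.consEquiv (n := n) (fun _ => A)).sum_comp, Fintype.sum_prod_type_right]
  rfl

lemma sum_words_snoc {A : Type*} [Fintype A] {M : Type*} [AddCommMonoid M] {n : ℕ}
    (f : (Fin (n + 1) → A) → M) :
    ∑ w, f w = ∑ w : Fin n → A, ∑ a, f (Fin.snoc w a : Fin (n + 1) → A) := by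
  rw [← (Fin.snocEquiv (n := n) (fun _ => A)).sum_comp, Fintype.sum_prod_type_right]
  rfl

/-- A sequence whose increments are eventually at most `g` grows at asymptotic rate at most `g`. -/
lemma rate_le_of_increment_le {u : ℕ → ℝ} {h g : ℝ} {N : ℕ}
    (hu : Filter.Tendsto (fun n : ℕ => u n / n) Filter.atTop (nhds h))
    (hg : ∀ n ≥ N, u (n + 1) ≤ u n + g) : h ≤ g := by
  have h1 : ∀ k : ℕ, u (N + k) ≤ u N + k * g := by
    intro k
    induction k with
    | zero => simp
    | succ k ih =>
      have := hg (N + k) (by omega)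
      push_cast
      rw [← add_assoc]
      linarith
  have h2 : ∀ n ≥ N + 1, u n / n ≤ (u N - N * g) / n + g := by
    intro n hn
    have h3 := h1 (n - N)
    rw [Nat.add_sub_cancel' (by omega : N ≤ n), Nat.cast_sub (by omega : N ≤ n)] at h3
    have hn0 : (0 : ℝ) < n := by
      have : 0 < n := by omega
      exact_mod_cast this
    rw [div_add' _ _ _ hn0.ne']
    exact div_le_div_of_nonneg_right (by linarith) hn0.le
  have h4 : Filter.Tendsto (fun n : ℕ => (u N - N * g) / (n : ℝ) + g) Filter.atTop
      (nhds (0 + g)) :=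
    (tendsto_const_div_atTop_nhds_zero_nat _).add_const g
  rw [zero_add] at h4
  exact le_of_tendsto_of_tendsto hu h4
    (Filter.eventually_atTop.2 ⟨N + 1, fun n hn => h2 n hn⟩)

/-- A consistent, shift-invariant family of probability weights on words over the graph `E`, in
which every symbol of positive weight has exactly `P` predecessors. -/
structure WordWeights {A : Type*} [Fintype A] (E : A → A → Prop) (P : ℕ)
    (q : ∀ n : ℕ, (Fin n → A) → ℝ) : Prop where
  pos : P ≠ 0
  nonneg : ∀ n w, 0 ≤ q n w
  cons : ∀ n w, ∑ b, q (n + 1) (Fin.cons b w) = q n w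
  snoc : ∀ n w, ∑ b, q (n + 1) (Fin.snoc w b : Fin (n + 1) → A) = q n w
  total : ∀ n, ∑ w, q n w = 1
  carried : ∀ n (w : Fin (n + 1) → A) b, ¬ E b (w 0) → q (n + 2) (Fin.cons b w) = 0
  regular : ∀ n (w : Fin (n + 1) → A), q (n + 1) w ≠ 0 → {b | E b (w 0)}.ncard = P

namespace WordWeights

open InformationTheory

variable {A : Type*} [Fintype A] {E : A → A → Prop} {P : ℕ} {q : ∀ n : ℕ, (Fin n → A) → ℝ}

open Classical in
/-- One word's contribution to the entropy deficit. -/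
def deficitTerm (E : A → A → Prop) (P : ℕ) (q : ∀ n : ℕ, (Fin n → A) → ℝ) (n : ℕ)
    (w : Fin (n + 1) → A) (b : A) : ℝ :=
  if E b (w 0) then q (n + 1) w / P * klFun (P * q (n + 2) (Fin.cons b w) / q (n + 1) w) else 0

/-- The amount by which the conditional entropy of a symbol, given the next `n + 1` symbols, falls
short of `log P`. -/
def deficit (E : A → A → Prop) (P : ℕ) (q : ∀ n : ℕ, (Fin n → A) → ℝ) (n : ℕ) : ℝ :=
  ∑ w, ∑ b, deficitTerm E P q n w b

lemma deficitTerm_nonneg (h : WordWeights E P q) (n : ℕ) (w : Fin (n + 1) → A) (b : A) :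
    0 ≤ deficitTerm E P q n w b := by
  unfold deficitTerm
  split_ifs
  · have := h.nonneg (n + 1) w
    have := h.nonneg (n + 2) (Fin.cons b w)
    exact mul_nonneg (by positivity) (klFun_nonneg (by positivity))
  · exact le_rfl

lemma cons_eq_zero (h : WordWeights E P q) {n : ℕ} {w : Fin n → A} (hw : q n w = 0) (b : A) :
    q (n + 1) (Fin.cons b w) = 0 := by
  have h1 := h.cons n w
  rw [hw, Finset.sum_eq_zero_iff_of_nonneg (fun b _ => h.nonneg _ _)] at h1
  exact h1 b (Finset.mem_univ _)

lemma sum_deficitTerm (h : WordWeights E P q) (n : ℕ) (w : Fin (n + 1) → A) :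
    ∑ b, deficitTerm E P q n w b = q (n + 1) w * Real.log P + Real.negMulLog (q (n + 1) w)
      - ∑ b, Real.negMulLog (q (n + 2) (Fin.cons b w)) := by
  classical
  by_cases hw : q (n + 1) w = 0
  · simp [deficitTerm, hw, h.cons_eq_zero hw]
  have hP : (P : ℝ) ≠ 0 := by exact_mod_cast h.pos
  have key : ∀ b, deficitTerm E P q n w b =
      q (n + 2) (Fin.cons b w) * (Real.log P - Real.log (q (n + 1) w))
        - Real.negMulLog (q (n + 2) (Fin.cons b w))
        + ((if E b (w 0) then q (n + 1) w / P else 0) - q (n + 2) (Fin.cons b w)) := by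
    intro b
    unfold deficitTerm
    split_ifs with hb
    · by_cases h0 : q (n + 2) (Fin.cons b w) = 0
      · simp [h0, klFun]
      · rw [klFun, Real.log_div (mul_ne_zero hP h0) hw, Real.log_mul hP h0, Real.negMulLog]
        field_simp
        ring
    · simp [h.carried n w b hb]
  have hcard : ∑ b, (if E b (w 0) then q (n + 1) w / P else 0) = q (n + 1) w := by
    rw [← Finset.sum_filter, Finset.sum_const, nsmul_eq_mul]
    have h2 := h.regular n w hw
    rw [Set.ncard_eq_toFinset_card'] at h2
    have h3 : (Finset.univ.filter fun b => E b (w 0)).card = P := by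
      rw [← h2]; congr 1; ext; simp
    rw [h3]
    field_simp
  simp only [key, Finset.sum_add_distrib, Finset.sum_sub_distrib, hcard, ← Finset.sum_mul,
    h.cons]
  rw [Real.negMulLog]
  ring

/-- The entropy of the words of length `n`. -/
def entropy (q : ∀ n : ℕ, (Fin n → A) → ℝ) (n : ℕ) : ℝ := ∑ w, Real.negMulLog (q n w)

lemma deficit_eq (h : WordWeights E P q) (n : ℕ) :
    deficit E P q n = Real.log P + entropy q (n + 1) - entropy q (n + 2) := by
  simp only [deficit, h.sum_deficitTerm, Finset.sum_sub_distrib, Finset.sum_add_distrib,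
    ← Finset.sum_mul, h.total, one_mul, entropy]
  rw [sum_words_cons (n := n + 1)]

lemma deficitTerm_le (h : WordWeights E P q) (n : ℕ) (w : Fin (n + 1) → A) (b : A) :
    deficitTerm E P q n w b ≤
      ∑ a, deficitTerm E P q (n + 1) (Fin.snoc w a : Fin (n + 2) → A) b := by
  classical
  have hP : (P : ℝ) ≠ 0 := by exact_mod_cast h.pos
  by_cases hw : q (n + 1) w = 0
  · refine le_trans (le_of_eq ?_) (Finset.sum_nonneg fun a _ => h.deficitTerm_nonneg _ _ _)
    simp [deficitTerm, hw]
  have h0 : ∀ a, (Fin.snoc w a : Fin (n + 2) → A) 0 = w 0 := fun a =>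
    Fin.snoc_castSucc (α := fun _ => A) (x := a) (p := w) (i := 0)
  by_cases hb : E b (w 0)
  swap
  · simp [deficitTerm, hb, h0]
  simp only [deficitTerm, h0, hb, if_true]
  have hcs : ∀ a, (Fin.cons b (Fin.snoc w a : Fin (n + 2) → A) : Fin (n + 3) → A) =
      (Fin.snoc (Fin.cons b w : Fin (n + 2) → A) a : Fin (n + 3) → A) := fun a =>
    Fin.cons_snoc_eq_snoc_cons (β := A) b w a
  simp only [hcs]
  have hq := h.nonneg (n + 1) w
  have J := convexOn_klFun.map_sum_le (t := (Finset.univ : Finset A))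
    (w := fun a => q (n + 2) (Fin.snoc w a : Fin (n + 2) → A) / q (n + 1) w)
    (p := fun a => P * q (n + 3) (Fin.snoc (Fin.cons b w : Fin (n + 2) → A) a : Fin (n + 3) → A)
      / q (n + 2) (Fin.snoc w a : Fin (n + 2) → A))
    (fun a _ => div_nonneg (h.nonneg _ _) hq)
    (by rw [← Finset.sum_div, h.snoc, div_self hw])
    (fun a _ => div_nonneg (mul_nonneg (Nat.cast_nonneg _) (h.nonneg _ _)) (h.nonneg _ _))
  simp only [smul_eq_mul] at J
  have h5 : ∑ a, q (n + 2) (Fin.snoc w a : Fin (n + 2) → A) / q (n + 1) w *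
      (P * q (n + 3) (Fin.snoc (Fin.cons b w : Fin (n + 2) → A) a : Fin (n + 3) → A)
      / q (n + 2) (Fin.snoc w a : Fin (n + 2) → A)) =
      P * q (n + 2) (Fin.cons b w) / q (n + 1) w := by
    rw [← h.snoc (n + 2) (Fin.cons b w), Finset.mul_sum, Finset.sum_div]
    refine Finset.sum_congr rfl fun a _ => ?_
    by_cases hz : q (n + 2) (Fin.snoc w a : Fin (n + 2) → A) = 0
    · rw [hz, ← hcs a, h.cons_eq_zero hz]
      simp
    · field_simp
  rw [h5] at J
  calc _ ≤ q (n + 1) w / P * _ := mul_le_mul_of_nonneg_left J (by positivity)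
    _ = _ := by
      rw [Finset.mul_sum]
      refine Finset.sum_congr rfl fun a _ => ?_
      field_simp

lemma deficit_le_succ (h : WordWeights E P q) (n : ℕ) :
    deficit E P q n ≤ deficit E P q (n + 1) := by
  unfold deficit
  rw [sum_words_snoc (n := n + 1)]
  refine Finset.sum_le_sum fun w _ => ?_
  rw [Finset.sum_comm]
  exact Finset.sum_le_sum fun b _ => h.deficitTerm_le n w b

/-- A family of weights whose entropy is at least `log P` is uniform on predecessors. -/
theorem uniform (h : WordWeights E P q) {ent : ℝ}
    (hent : Filter.Tendsto (fun n : ℕ => entropy q n / n) Filter.atTop (nhds ent))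
    (hge : Real.log P ≤ ent) (n : ℕ) (w : Fin (n + 1) → A) (b : A) :
    (E b (w 0) → q (n + 2) (Fin.cons b w) * P = q (n + 1) w) ∧
      (¬ E b (w 0) → q (n + 2) (Fin.cons b w) = 0) := by
  refine ⟨fun hb => ?_, h.carried n w b⟩
  have hP : (P : ℝ) ≠ 0 := by exact_mod_cast h.pos
  have hD0 : 0 ≤ deficit E P q n :=
    Finset.sum_nonneg fun w _ => Finset.sum_nonneg fun b _ => h.deficitTerm_nonneg n w b
  have hmono : Monotone (deficit E P q) := monotone_nat_of_le_succ h.deficit_le_succ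
  have hrate : ent ≤ Real.log P - deficit E P q n := by
    refine rate_le_of_increment_le (N := n + 1) hent fun k hk => ?_
    obtain ⟨m, rfl⟩ : ∃ m, k = m + 1 := ⟨k - 1, by omega⟩
    have h1 := h.deficit_eq m
    have h2 := hmono (show n ≤ m by omega)
    linarith
  have hD : deficit E P q n = 0 := by linarith
  unfold deficit at hD
  rw [Finset.sum_eq_zero_iff_of_nonneg
    (fun w _ => Finset.sum_nonneg fun b _ => h.deficitTerm_nonneg n w b)] at hD
  have hD2 := hD w (Finset.mem_univ _)
  rw [Finset.sum_eq_zero_iff_of_nonneg (fun b _ => h.deficitTerm_nonneg n w b)] at hD2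
  have hD3 := hD2 b (Finset.mem_univ _)
  by_cases hw : q (n + 1) w = 0
  · rw [h.cons_eq_zero hw, hw, zero_mul]
  simp only [deficitTerm, hb, if_true] at hD3
  rcases mul_eq_zero.1 hD3 with h4 | h4
  · exact absurd h4 (div_ne_zero hw hP)
  · rw [klFun_eq_zero_iff (div_nonneg (mul_nonneg (Nat.cast_nonneg _) (h.nonneg _ _))
      (h.nonneg _ _)), div_eq_one_iff_eq hw] at h4
    linarith

end WordWeights

/-! ### Translations, reflections and cylinder sets -/

def translate {A : Type*} (v : ℤ) (x : ℤ → A) : ℤ → A := fun j => x (j + v)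

def reflect {A : Type*} (x : ℤ → A) : ℤ → A := fun j => x (-j)

/-- The configurations that agree with `c` on `[p, q]`. -/
def cyl {A : Type*} (c : ℤ → A) (p q : ℤ) : Set (ℤ → A) := {x | ∀ j, p ≤ j → j ≤ q → x j = c j}

lemma translate_translate {A : Type*} (u v : ℤ) (x : ℤ → A) :
    translate u (translate v x) = translate (u + v) x := by
  funext j; simp [translate, add_assoc]

lemma translate_zero {A : Type*} (x : ℤ → A) : translate 0 x = x := by
  funext j; simp [translate]

lemma reflect_reflect {A : Type*} (x : ℤ → A) : reflect (reflect x) = x := by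
  funext j; simp [reflect]

lemma reflect_translate {A : Type*} (v : ℤ) (x : ℤ → A) :
    reflect (translate v x) = translate (-v) (reflect x) := by
  funext j; simp only [reflect, translate]; congr 1; ring

lemma cyl_subset_cyl {A : Type*} (c : ℤ → A) {p q p' q' : ℤ} (hp : p' ≤ p) (hq : q ≤ q') :
    cyl c p' q' ⊆ cyl c p q := fun _ hx j h1 h2 => hx j (by omega) (by omega)

lemma translate_preimage_cyl {A : Type*} (v : ℤ) (c : ℤ → A) (p q : ℤ) :
    translate v ⁻¹' cyl c p q = cyl (translate (-v) c) (p + v) (q + v) := by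
  ext x
  simp only [Set.mem_preimage, cyl, Set.mem_ofPred_eq, translate]
  constructor
  · intro h j h1 h2
    have := h (j - v) (by omega) (by omega)
    simpa [sub_eq_add_neg, add_assoc] using this
  · intro h j h1 h2
    have := h (j + v) (by omega) (by omega)
    simpa [add_assoc] using this

lemma reflect_preimage_cyl {A : Type*} (c : ℤ → A) (p q : ℤ) :
    reflect ⁻¹' cyl c p q = cyl (reflect c) (-q) (-p) := by
  ext x
  simp only [Set.mem_preimage, cyl, Set.mem_ofPred_eq, reflect]
  constructor
  · intro h j h1 h2
    simpa using h (-j) (by omega) (by omega)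
  · intro h j h1 h2
    simpa using h (-j) (by omega) (by omega)

section Measurability

variable {A : Type*} [MeasurableSpace A]

lemma measurable_translate (v : ℤ) : Measurable (translate v : (ℤ → A) → ℤ → A) :=
  measurable_pi_lambda _ fun _ => measurable_pi_apply _

lemma measurable_reflect : Measurable (reflect : (ℤ → A) → ℤ → A) :=
  measurable_pi_lambda _ fun _ => measurable_pi_apply _

lemma measurableSet_coord_eq [MeasurableSingletonClass A] (j : ℤ) (a : A) :
    MeasurableSet {x : ℤ → A | x j = a} := by
  have h : MeasurableSet ((fun x : ℤ → A => x j) ⁻¹' {a}) :=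
    measurable_pi_apply j (measurableSet_singleton a)
  exact h

lemma measurableSet_cyl [MeasurableSingletonClass A] (c : ℤ → A) (p q : ℤ) :
    MeasurableSet (cyl c p q) := by
  simp only [cyl, Set.ofPred_forall]
  exact MeasurableSet.iInter fun j => MeasurableSet.iInter fun _ => MeasurableSet.iInter fun _ =>
    measurableSet_coord_eq j (c j)

end Measurability

/-- The measure of a set is the sum of the measures of its intersections with the fibres of a
finite-valued map. -/
lemma measure_eq_sum_inter_fiber {Ω X : Type*} [MeasurableSpace Ω] [Fintype X] [MeasurableSpace X]
    [MeasurableSingletonClass X] (ν : Measure Ω) {f : Ω → X} (hf : Measurable f) (S : Set Ω) :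
    ν S = ∑ b, ν (S ∩ f ⁻¹' {b}) := by
  have h := sum_measure_preimage_singleton (μ := ν.restrict S) Finset.univ (f := f)
    (fun y _ => hf (measurableSet_singleton y))
  rw [Finset.coe_univ, Set.preimage_univ, Measure.restrict_apply_univ] at h
  rw [← h]
  refine Finset.sum_congr rfl fun b _ => ?_
  rw [Measure.restrict_apply (hf (measurableSet_singleton b)), Set.inter_comm]

lemma measureReal_eq_sum_inter_fiber {Ω X : Type*} [MeasurableSpace Ω] [Fintype X]
    [MeasurableSpace X] [MeasurableSingletonClass X] (ν : Measure Ω) [IsFiniteMeasure ν]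
    {f : Ω → X} (hf : Measurable f) (S : Set Ω) :
    ν.real S = ∑ b, ν.real (S ∩ f ⁻¹' {b}) := by
  simp only [measureReal_def]
  rw [measure_eq_sum_inter_fiber ν hf S, ENNReal.toReal_sum]
  exact fun _ _ => measure_ne_top _ _

/-! ### Invariant measures of maximal entropy are uniform on predecessors -/

open Classical in
/-- Outside `[p, q]`, on the left, the measure `ν` is uniform on the `P` predecessors under `E`. -/
def LeftUniform {A : Type*} [MeasurableSpace A] (E : A → A → Prop) (P : ℕ) (ν : Measure (ℤ → A))
    (p q : ℤ) : Prop :=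
  ∀ p' ≤ p, ∀ q' ≥ q, ∀ c : ℤ → A,
    ν (cyl c (p' - 1) q') * P = if E (c (p' - 1)) (c p') then ν (cyl c p' q') else 0

/-- Outside `[p, q]`, on the right, `ν` is uniform on the `P` followers under `E`. -/
def RightUniform {A : Type*} [MeasurableSpace A] (E : A → A → Prop) (P : ℕ) (ν : Measure (ℤ → A))
    (p q : ℤ) : Prop :=
  LeftUniform (fun a b => E b a) P (ν.map reflect) (-q) (-p)

section Invariant

variable {A : Type*} [MeasurableSpace A] [MeasurableSingletonClass A]

lemma measure_cyl_translate {η : Measure (ℤ → A)} (hη : MeasurePreserving shift η η)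
    (c : ℤ → A) (p q v : ℤ) : η (cyl (translate v c) (p - v) (q - v)) = η (cyl c p q) := by
  have one : ∀ (c : ℤ → A) (p q : ℤ),
      η (cyl (translate 1 c) (p - 1) (q - 1)) = η (cyl c p q) := by
    intro c p q
    rw [← hη.measure_preimage (measurableSet_cyl _ _ _).nullMeasurableSet]
    change η (translate 1 ⁻¹' _) = _
    rw [translate_preimage_cyl, translate_translate]
    simp [translate_zero]
  have nat : ∀ (n : ℕ) (c : ℤ → A) (p q : ℤ),
      η (cyl (translate n c) (p - n) (q - n)) = η (cyl c p q) := by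
    intro n
    induction n with
    | zero => intro c p q; simp [translate_zero]
    | succ n ih =>
      intro c p q
      rw [← ih c p q, ← one (translate n c) (p - n) (q - n), translate_translate]
      push_cast
      rw [add_comm (1 : ℤ) n, sub_sub, sub_sub]
  obtain ⟨n, rfl | rfl⟩ := v.eq_nat_or_neg
  · exact nat n c p q
  · rw [← nat n, translate_translate]
    simp [translate_zero]

/-- The weight of a word. -/
def wordWeight (η : Measure (ℤ → A)) (n : ℕ) (w : Fin n → A) : ℝ :=
  η.real {x | ∀ i : Fin n, x (i : ℕ) = w i}

lemma wordWeight_eq {η : Measure (ℤ → A)} (hη : MeasurePreserving shift η η) (c : ℤ → A) (p : ℤ)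
    (n : ℕ) : wordWeight η n (fun i => c (p + (i : ℕ))) = η.real (cyl c p (p + n - 1)) := by
  rw [measureReal_def, ← measure_cyl_translate hη c p _ p, wordWeight, measureReal_def]
  congr 2
  ext x
  simp only [Set.mem_ofPred_eq, cyl, translate]
  constructor
  · intro h j h1 h2
    have := h ⟨j.toNat, by omega⟩
    simp only [Int.toNat_of_nonneg (show 0 ≤ j by omega)] at this
    rw [this, add_comm]
  · intro h i
    rw [h i (by omega) (by omega), add_comm]

variable [Fintype A]

lemma measurable_window (n : ℕ) :
    Measurable (fun (x : ℤ → A) (i : Fin n) => x ((i : ℕ) : ℤ)) :=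
  measurable_pi_lambda _ fun _ => measurable_pi_apply _

lemma wordWeights_of_invariant {η : Measure (ℤ → A)} [IsProbabilityMeasure η]
    (hη : MeasurePreserving shift η η) {E : A → A → Prop} {P : ℕ} (hP : P ≠ 0)
    (hE : ∀ᵐ x ∂η, ∀ j, E (x j) (x (j + 1)) ∧ {b | E b (x j)}.ncard = P) :
    WordWeights E P (wordWeight η) where
  pos := hP
  nonneg _ _ := measureReal_nonneg
  cons n w := by
    have h1 : η.real {x | ∀ i : Fin n, x ((i : ℕ) + 1) = w i} = wordWeight η n w := by
      rw [wordWeight, measureReal_def, measureReal_def]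
      congr 1
      refine hη.measure_preimage (s := {x | ∀ i : Fin n, x (i : ℕ) = w i}) ?_
      refine MeasurableSet.nullMeasurableSet ?_
      simp only [Set.ofPred_forall]
      exact MeasurableSet.iInter fun i => measurableSet_coord_eq _ (w i)
    rw [← h1, measureReal_eq_sum_inter_fiber η (measurable_pi_apply (0 : ℤ))]
    refine Finset.sum_congr rfl fun b _ => ?_
    rw [wordWeight]
    congr 1
    ext x
    simp [Fin.forall_fin_succ, and_comm]
  snoc n w := by
    rw [wordWeight, measureReal_eq_sum_inter_fiber η (measurable_pi_apply (n : ℤ))]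
    refine Finset.sum_congr rfl fun b _ => ?_
    rw [wordWeight]
    congr 1
    ext x
    simp [Fin.forall_fin_succ']
  total n := by
    have h := measureReal_eq_sum_inter_fiber η (measurable_window (A := A) n) Set.univ
    rw [probReal_univ] at h
    rw [h]
    refine Finset.sum_congr rfl fun w _ => ?_
    rw [wordWeight]
    congr 1
    ext x
    simp [funext_iff]
  carried n w b hb := by
    rw [wordWeight, measureReal_eq_zero_iff]
    refine measure_eq_zero_iff_ae_notMem.2 (hE.mono fun x hx hmem => hb ?_)
    have h0 := hmem 0
    have h1 := hmem 1
    have h2 := (hx 0).1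
    simp only [Fin.val_zero, Fin.cons_zero, Nat.cast_zero] at h0
    have h3 : (Fin.cons b w : Fin (n + 2) → A) 1 = w 0 := rfl
    rw [h3] at h1
    have h4 : (((1 : Fin (n + 2)) : ℕ) : ℤ) = 0 + 1 := by simp
    rw [h4] at h1
    rwa [h0, h1] at h2
  regular n w hw := by
    by_contra hne
    refine hw ?_
    rw [wordWeight, measureReal_eq_zero_iff]
    refine measure_eq_zero_iff_ae_notMem.2 (hE.mono fun x hx hmem => hne ?_)
    have h0 := hmem 0
    simp only [Fin.val_zero, Nat.cast_zero] at h0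
    rw [← h0]
    exact (hx 0).2

theorem leftUniform_of_entropy {η : Measure (ℤ → A)} [IsProbabilityMeasure η]
    (hη : MeasurePreserving shift η η) {E : A → A → Prop} {P : ℕ} (hP : P ≠ 0)
    (hE : ∀ᵐ x ∂η, ∀ j, E (x j) (x (j + 1)) ∧ {b | E b (x j)}.ncard = P) {ent : ℝ}
    (hent : HasEntropy η ent) (hge : Real.log P ≤ ent) {p q : ℤ} (hpq : p ≤ q) :
    LeftUniform E P η p q := by
  intro p' hp' q' hq' c
  obtain ⟨n, hn⟩ : ∃ n : ℕ, q' = p' + n := ⟨(q' - p').toNat, by omega⟩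
  have h := (wordWeights_of_invariant hη hP hE).uniform hent hge n
    (fun i => c (p' + (i : ℕ))) (c (p' - 1))
  have h1 : (Fin.cons (c (p' - 1)) (fun i : Fin (n + 1) => c (p' + (i : ℕ))) : Fin (n + 2) → A)
      = fun i : Fin (n + 2) => c (p' - 1 + (i : ℕ)) := by
    funext i
    refine Fin.cases (by simp) (fun i => ?_) i
    simp only [Fin.cons_succ, Fin.val_succ]
    congr 1
    push_cast
    ring
  rw [h1, wordWeight_eq hη, wordWeight_eq hη] at h
  have e1 : p' - 1 + ((n + 2 : ℕ) : ℤ) - 1 = q' := by push_cast; omega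
  have e2 : p' + ((n + 1 : ℕ) : ℤ) - 1 = q' := by push_cast; omega
  have e3 : p' + (((0 : Fin (n + 1)) : ℕ) : ℤ) = p' := by simp
  rw [e1, e2, e3] at h
  split_ifs with hEE
  · have h2 := h.1 hEE
    rw [← ENNReal.toReal_eq_toReal_iff' (ENNReal.mul_ne_top (measure_ne_top _ _)
      (ENNReal.natCast_ne_top P)) (measure_ne_top _ _), ENNReal.toReal_mul]
    simpa [measureReal_def] using h2
  · have h2 := h.2 hEE
    rw [measureReal_eq_zero_iff] at h2
    rw [h2, zero_mul]

lemma hasEntropy_map_reflect {η : Measure (ℤ → A)} (hη : MeasurePreserving shift η η) {ent : ℝ}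
    (h : HasEntropy η ent) : HasEntropy (η.map reflect) ent := by
  have : blockEntropy (η.map reflect) = blockEntropy η := by
    funext n
    unfold blockEntropy
    rw [← (Equiv.arrowCongr (Fin.revPerm (n := n)) (Equiv.refl A)).sum_comp]
    refine Finset.sum_congr rfl fun w _ => ?_
    congr 1
    rcases Nat.eq_zero_or_pos n with rfl | hn
    · simp [measureReal_def, Measure.map_apply measurable_reflect MeasurableSet.univ]
    set c : ℤ → A := fun j => w ⟨j.toNat % n, Nat.mod_lt _ hn⟩ with hc
    have hcw : ∀ i : Fin n, c ((i : ℕ) : ℤ) = w i := fun i => by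
      simp [hc, Nat.mod_eq_of_lt i.2]
    have e1 : {x : ℤ → A | ∀ i : Fin n, x (i : ℕ) = w i} = cyl c 0 (n - 1) := by
      ext x
      simp only [Set.mem_ofPred_eq, cyl]
      constructor
      · intro h j h1 h2
        have := h ⟨j.toNat, by omega⟩
        rw [← hcw] at this
        simpa [Int.toNat_of_nonneg h1] using this
      · intro h i
        rw [h i (by omega) (by omega), hcw]
    have e2 : reflect ⁻¹' {x : ℤ → A | ∀ i : Fin n, x (i : ℕ) =
        (Equiv.arrowCongr (Fin.revPerm (n := n)) (Equiv.refl A)) w i} =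
        cyl (translate (n - 1) c) (0 - (n - 1)) (n - 1 - (n - 1)) := by
      ext x
      simp only [Set.mem_ofPred_eq, cyl, Set.mem_preimage, reflect, translate]
      constructor
      · intro h j h1 h2
        have := h ⟨(-j).toNat, by omega⟩
        simp only [Int.toNat_of_nonneg (show 0 ≤ -j by omega), neg_neg] at this
        rw [this, Equiv.arrowCongr_apply]
        simp only [Function.comp, Equiv.refl_apply, Fin.revPerm_symm, Fin.revPerm_apply]
        rw [← hcw]
        congr 1
        simp only [Fin.val_rev]
        omega
      · intro h i
        rw [h (-(i : ℕ)) (by omega) (by omega), Equiv.arrowCongr_apply]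
        simp only [Function.comp, Equiv.refl_apply, Fin.revPerm_symm, Fin.revPerm_apply]
        rw [← hcw]
        congr 1
        simp only [Fin.val_rev]
        omega
    have hm : MeasurableSet {x : ℤ → A | ∀ i : Fin n, x (i : ℕ) =
        (Equiv.arrowCongr (Fin.revPerm (n := n)) (Equiv.refl A)) w i} := by
      simp only [Set.ofPred_forall]
      exact MeasurableSet.iInter fun i => measurableSet_coord_eq _ _
    rw [measureReal_def, measureReal_def, Measure.map_apply measurable_reflect hm, e2,
      measure_cyl_translate hη, ← e1]
  unfold HasEntropy
  rw [this]
  exact h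

lemma measurePreserving_shift_map_reflect {η : Measure (ℤ → A)}
    (hη : MeasurePreserving shift η η) [IsFiniteMeasure η] :
    MeasurePreserving shift (η.map reflect) (η.map reflect) := by
  have hsm : Measurable (shift : (ℤ → A) → ℤ → A) := measurable_translate 1
  refine ⟨hsm, ?_⟩
  conv_lhs => rw [← hη.map_eq]
  rw [Measure.map_map measurable_reflect hη.measurable,
    Measure.map_map hsm (measurable_reflect.comp hη.measurable)]
  congr 1
  funext x
  funext j
  simp [shift, reflect]

end Invariant

/-! ### Markov subshifts and the number of their words -/

section Subshift

variable {A : Type*} {S : Set (ℤ → A)}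

lemma IsMarkovSubshift.adm (hS : IsMarkovSubshift S) {s : ℤ → A} (hs : s ∈ S) (j : ℤ) :
    Adm S (s j) (s (j + 1)) := (hS s).1 hs j

lemma IsMarkovSubshift.translate_mem (hS : IsMarkovSubshift S) {s : ℤ → A} (hs : s ∈ S) (v : ℤ) :
    translate v s ∈ S := by
  rw [hS]
  intro z
  have := hS.adm hs (z + v)
  simp only [translate]
  convert this using 2
  ring

lemma Adm.exists_mem {a b : A} (h : Adm S a b) : ∃ s ∈ S, s 0 = a ∧ s 1 = b := by
  obtain ⟨s, hs, hi⟩ := h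
  exact ⟨s, hs, by simpa using hi 0, by simpa using hi 1⟩

lemma mem_symbols (hS : IsMarkovSubshift S) {s : ℤ → A} (hs : s ∈ S) (j : ℤ) :
    s j ∈ symbols S := ⟨translate j s, hS.translate_mem hs j, by simp [translate]⟩

/-- A path of admissible transitions on `[p, q]` extends to an element of the subshift. -/
lemma IsMarkovSubshift.exists_extension (hS : IsMarkovSubshift S) {x : ℤ → A} {p q : ℤ}
    (hpq : p < q) (hx : ∀ j, p ≤ j → j < q → Adm S (x j) (x (j + 1))) :
    ∃ s ∈ S, ∀ j, p ≤ j → j ≤ q → s j = x j := by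
  obtain ⟨l, hl, hl0, -⟩ := (hx p le_rfl hpq).exists_mem
  obtain ⟨r, hr, -, hr1⟩ := (hx (q - 1) (by omega) (by omega)).exists_mem
  rw [sub_add_cancel] at hr1
  refine ⟨fun j => if j < p then l (j - p) else if j ≤ q then x j else r (j - q + 1), ?_, ?_⟩
  · rw [hS]
    intro z
    by_cases h1 : z + 1 < p
    · have := hS.adm hl (z - p)
      simp only [h1, show z < p by omega, if_true]
      convert this using 2
      ring
    by_cases h2 : z < p
    · have := hS.adm hl (z - p)
      simp only [h1, h2, if_true, if_false, show z + 1 ≤ q by omega]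
      have e : z - p + 1 = 0 := by omega
      rw [e, hl0] at this
      convert this using 2
      omega
    by_cases h3 : z < q
    · simp only [h1, h2, if_false, show z ≤ q by omega, show z + 1 ≤ q by omega, if_true]
      exact hx z (by omega) h3
    have := hS.adm hr (z - q + 1)
    by_cases h4 : z = q
    · subst h4
      simp only [h1, h2, if_false, le_refl, if_true, show ¬ z + 1 ≤ z by omega]
      have e : z - z + 1 = 1 := by omega
      rw [e, hr1] at this
      convert this using 2
      omega
    · simp only [h1, h2, if_false, show ¬ z ≤ q by omega, show ¬ z + 1 ≤ q by omega]
      convert this using 2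
      ring
  · intro j h1 h2
    simp [show ¬ j < p by omega, h2]

variable [Fintype A]

lemma ncard_eq_sum_ite {X : Type*} [Fintype X] (T : Set X) [DecidablePred (· ∈ T)] :
    T.ncard = ∑ x, if x ∈ T then 1 else 0 := by
  rw [Finset.sum_boole, Set.ncard_eq_toFinset_card']
  simp only [Nat.cast_id]
  congr 1
  ext
  simp

lemma words_card_left (hS : IsMarkovSubshift S) {P : ℕ}
    (hP : ∀ b ∈ symbols S, (pred S b).ncard = P) (n : ℕ) :
    P * (words S (n + 1)).ncard ≤ (words S (n + 2)).ncard := by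
  classical
  rw [ncard_eq_sum_ite, ncard_eq_sum_ite, sum_words_cons (n := n + 1), Finset.mul_sum]
  refine Finset.sum_le_sum fun w _ => ?_
  split_ifs with hw
  swap
  · simp
  obtain ⟨s, hs, hsw⟩ := hw
  have hs0 : s 0 = w 0 := by simpa using hsw 0
  rw [mul_one, ← hP (w 0) ⟨s, hs, hs0⟩, ncard_eq_sum_ite]
  refine Finset.sum_le_sum fun b _ => ?_
  split_ifs with h1 h2 <;> try simp
  refine h2 ?_
  obtain ⟨t, ht, ht0, ht1⟩ := Adm.exists_mem (show Adm S b (w 0) from h1)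
  obtain ⟨u, hu, hux⟩ := hS.exists_extension (p := 0) (q := n + 1)
    (x := fun j => if j ≤ 0 then t j else s (j - 1)) (by omega) (by
      intro j h3 h4
      rcases (show j = 0 ∨ 0 < j by omega) with rfl | h3
      · simp only [le_refl, if_true, zero_add, show ¬ (1 : ℤ) ≤ 0 by omega, if_false, sub_self,
          ht0, hs0]
        exact h1
      · simp only [show ¬ j ≤ 0 by omega, show ¬ j + 1 ≤ 0 by omega, if_false]
        have := hS.adm hs (j - 1)
        convert this using 2
        ring)
  refine ⟨u, hu, fun i => ?_⟩
  rw [hux _ (by omega) (by omega)]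
  refine Fin.cases (by simp [ht0]) (fun i => ?_) i
  simp only [Fin.val_succ, Fin.cons_succ]
  rw [if_neg (by omega), ← hsw i]
  congr 1
  push_cast
  ring

lemma words_card_right (hS : IsMarkovSubshift S) {P : ℕ}
    (hP : ∀ b ∈ symbols S, (follow S b).ncard = P) (n : ℕ) :
    P * (words S (n + 1)).ncard ≤ (words S (n + 2)).ncard := by
  classical
  rw [ncard_eq_sum_ite, ncard_eq_sum_ite, sum_words_snoc (n := n + 1), Finset.mul_sum]
  refine Finset.sum_le_sum fun w _ => ?_
  split_ifs with hw
  swap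
  · simp
  obtain ⟨s, hs, hsw⟩ := hw
  have hs0 : s n = w (Fin.last n) := by simpa using hsw (Fin.last n)
  rw [mul_one, ← hP (w (Fin.last n)) (hs0 ▸ mem_symbols hS hs n), ncard_eq_sum_ite]
  refine Finset.sum_le_sum fun b _ => ?_
  split_ifs with h1 h2 <;> try simp
  refine h2 ?_
  obtain ⟨u, hu, hux⟩ := hS.exists_extension (p := 0) (q := n + 1)
    (x := fun j => if j ≤ n then s j else b) (by omega) (by
      intro j h3 h4
      rcases (show j = n ∨ j < n by omega) with rfl | h3
      · simp only [le_refl, if_true, show ¬ (n : ℤ) + 1 ≤ n by omega, if_false, hs0]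
        exact h1
      · simp only [show j ≤ n by omega, show j + 1 ≤ n by omega, if_true]
        exact hS.adm hs j)
  refine ⟨u, hu, fun i => ?_⟩
  rw [hux _ (by omega) (by omega)]
  refine Fin.lastCases (by simp) (fun i => ?_) i
  simp only [Fin.val_castSucc, Fin.snoc_castSucc]
  rw [if_pos (by omega), ← hsw i]

lemma log_le_of_words_card (hS : S.Nonempty) {P : ℕ} (hP : P ≠ 0)
    (hw : ∀ n, P * (words S (n + 1)).ncard ≤ (words S (n + 2)).ncard) {h : ℝ}
    (hh : HasTopEntropy S h) : Real.log P ≤ h := by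
  have hpos : ∀ n, 0 < (words S n).ncard := fun n => by
    obtain ⟨s, hs⟩ := hS
    exact (Set.ncard_pos (Set.toFinite _)).2 ⟨fun i => s (i : ℕ), s, hs, fun _ => rfl⟩
  have hneg : Filter.Tendsto (fun n : ℕ => -Real.log ((words S n).ncard : ℝ) / n) Filter.atTop
      (nhds (-h)) := by
    refine (hh.neg).congr fun n => ?_
    rw [neg_div]
  have := rate_le_of_increment_le (g := -Real.log P) (N := 1) hneg (by
    intro n hn
    obtain ⟨m, rfl⟩ : ∃ m, n = m + 1 := ⟨n - 1, by omega⟩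
    have h1 : ((P * (words S (m + 1)).ncard : ℕ) : ℝ) ≤ ((words S (m + 2)).ncard : ℝ) := by
      exact_mod_cast hw m
    have hP0 : (0 : ℝ) < P := by exact_mod_cast Nat.pos_of_ne_zero hP
    have hm0 : (0 : ℝ) < (words S (m + 1)).ncard := by exact_mod_cast hpos _
    push_cast at h1
    have h2 := Real.log_le_log (by positivity) h1
    rw [Real.log_mul hP0.ne' hm0.ne'] at h2
    linarith)
  linarith

end Subshift

/-! ### Parry measures of regular Markov subshifts -/

section Parry

variable {A : Type*} [Fintype A] [MeasurableSpace A] [MeasurableSingletonClass A]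
  {S : Set (ℤ → A)} {η : Measure (ℤ → A)}

lemma IsParryMeasure.nonempty (h : IsParryMeasure S η) : S.Nonempty := by
  have := h.prob
  obtain ⟨x, hx⟩ := h.carried.exists
  exact ⟨x, hx⟩

theorem IsParryMeasure.leftUniform (h : IsParryMeasure S η) (hS : IsMarkovSubshift S) {P : ℕ}
    (hP : ∀ b ∈ symbols S, (pred S b).ncard = P) {p q : ℤ} (hpq : p ≤ q) :
    P ≠ 0 ∧ LeftUniform (Adm S) P η p q := by
  have := h.prob
  obtain ⟨s, hs⟩ := h.nonempty
  have hP0 : P ≠ 0 := by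
    rw [← hP (s 1) (mem_symbols hS hs 1)]
    exact ((Set.ncard_pos (Set.toFinite _)).2 ⟨s 0, hS.adm hs 0⟩).ne'
  obtain ⟨e, he, he'⟩ := h.maximal
  refine ⟨hP0, leftUniform_of_entropy h.invariant hP0 ?_ he
    (log_le_of_words_card ⟨s, hs⟩ hP0 (words_card_left hS hP) he') hpq⟩
  exact h.carried.mono fun x hx j => ⟨hS.adm hx j, hP _ (mem_symbols hS hx j)⟩

theorem IsParryMeasure.rightUniform (h : IsParryMeasure S η) (hS : IsMarkovSubshift S) {P : ℕ}
    (hP : ∀ b ∈ symbols S, (follow S b).ncard = P) {p q : ℤ} (hpq : p ≤ q) :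
    P ≠ 0 ∧ RightUniform (Adm S) P η p q := by
  have := h.prob
  obtain ⟨s, hs⟩ := h.nonempty
  have hP0 : P ≠ 0 := by
    rw [← hP (s 0) (mem_symbols hS hs 0)]
    exact ((Set.ncard_pos (Set.toFinite _)).2 ⟨s 1, hS.adm hs 0⟩).ne'
  obtain ⟨e, he, he'⟩ := h.maximal
  have := Measure.isProbabilityMeasure_map (μ := η) (measurable_reflect (A := A)).aemeasurable
  have hm : MeasurableSet {x : ℤ → A |
      ∀ j, Adm S (x (j + 1)) (x j) ∧ {b | Adm S (x j) b}.ncard = P} := by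
    rw [Set.ofPred_forall]
    refine MeasurableSet.iInter fun j => ?_
    have h1 : Measurable fun x : ℤ → A => (x (j + 1), x j) :=
      (measurable_pi_apply (j + 1)).prodMk (measurable_pi_apply j)
    have h2 : MeasurableSet {y : A × A | Adm S y.1 y.2 ∧ {b | Adm S y.2 b}.ncard = P} :=
      MeasurableSet.of_discrete
    exact h1 h2
  refine ⟨hP0, leftUniform_of_entropy (measurePreserving_shift_map_reflect h.invariant) hP0 ?_
    (hasEntropy_map_reflect h.invariant he)
    (log_le_of_words_card ⟨s, hs⟩ hP0 (words_card_right hS hP) he') (by omega)⟩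
  rw [ae_map_iff measurable_reflect.aemeasurable hm]
  refine h.carried.mono fun x hx j => ⟨?_, hP _ (mem_symbols hS hx (-j))⟩
  have := hS.adm hx (-(j + 1))
  simpa [reflect] using this

end Parry

/-! ### Operations that preserve uniformity -/

section Uniform

variable {A : Type*} [MeasurableSpace A] {E : A → A → Prop} {P : ℕ} {ν : Measure (ℤ → A)}
  {p q : ℤ} {φ : A → A → A → A}

lemma LeftUniform.mono (h : LeftUniform E P ν p q) {p₁ q₁ : ℤ} (hp : p₁ ≤ p) (hq : q ≤ q₁) :
    LeftUniform E P ν p₁ q₁ := fun p' hp' q' hq' => h p' (by omega) q' (by omega)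

lemma RightUniform.mono (h : RightUniform E P ν p q) {p₁ q₁ : ℤ} (hp : p₁ ≤ p) (hq : q ≤ q₁) :
    RightUniform E P ν p₁ q₁ := LeftUniform.mono h (by omega) (by omega)

variable [MeasurableSingletonClass A]

open Classical in
lemma rightUniform_iff : RightUniform E P ν p q ↔ ∀ p' ≤ p, ∀ q' ≥ q, ∀ c : ℤ → A,
    ν (cyl c p' (q' + 1)) * P = if E (c q') (c (q' + 1)) then ν (cyl c p' q') else 0 := by
  unfold RightUniform LeftUniform
  simp only [Measure.map_apply measurable_reflect (measurableSet_cyl _ _ _), reflect_preimage_cyl]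
  constructor
  · intro h p' hp' q' hq' c
    have := h (-q') (by omega) (-p') (by omega) (reflect c)
    simp only [reflect_reflect] at this
    have e : - (-q' - 1) = q' + 1 := by ring
    simpa [reflect, e] using this
  · intro h p' hp' q' hq' c
    have := h (-q') (by omega) (-p') (by omega) (reflect c)
    have e : - (p' - 1) = -p' + 1 := by ring
    have e' : - (-p' + 1) = p' - 1 := by ring
    simpa [reflect, e, e'] using this

lemma LeftUniform.translate (h : LeftUniform E P ν p q) (v : ℤ) :
    LeftUniform E P (ν.map (translate v)) (p - v) (q - v) := by
  intro p' hp' q' hq' c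
  have := h (p' + v) (by omega) (q' + v) (by omega) (DefectCA.translate (-v) c)
  have e : p' - 1 + v = p' + v - 1 := by ring
  have e1 : DefectCA.translate (-v) c (p' + v - 1) = c (p' - 1) := by
    simp only [DefectCA.translate]; congr 1; ring
  have e2 : DefectCA.translate (-v) c (p' + v) = c p' := by simp [DefectCA.translate]
  rw [e1, e2] at this
  simp only [Measure.map_apply (measurable_translate v) (measurableSet_cyl _ _ _),
    translate_preimage_cyl, e]
  exact this

lemma RightUniform.translate (h : RightUniform E P ν p q) (v : ℤ) :
    RightUniform E P (ν.map (translate v)) (p - v) (q - v) := by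
  unfold RightUniform at *
  have e : (ν.map (DefectCA.translate v)).map reflect =
      (ν.map reflect).map (DefectCA.translate (-v)) := by
    rw [Measure.map_map measurable_reflect (measurable_translate v),
      Measure.map_map (measurable_translate _) measurable_reflect]
    congr 1
    funext x
    exact reflect_translate v x
  rw [e]
  have := LeftUniform.translate h (-v)
  convert this using 1 <;> ring

lemma LeftUniform.restrict (h : LeftUniform E P ν p q) {S T : Set (ℤ → A)}
    (hT : ∀ᵐ x ∂ν, x ∈ T)
    (hS : ∀ x ∈ T, ∀ y ∈ T, (∀ j, p ≤ j → j ≤ q → x j = y j) → x ∈ S → y ∈ S) :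
    LeftUniform E P (ν.restrict S) p q := by
  intro p' hp' q' hq' c
  rw [Measure.restrict_apply (measurableSet_cyl _ _ _),
    Measure.restrict_apply (measurableSet_cyl _ _ _)]
  by_cases hex : ∃ y ∈ cyl c p' q', y ∈ T ∧ y ∈ S
  · obtain ⟨y, hy, hyT, hyS⟩ := hex
    have key : ∀ U ⊆ cyl c p' q', ν (U ∩ S) = ν U := by
      intro U hU
      refine measure_congr (hT.mono fun x hx => propext ⟨fun h => h.1, fun h => ⟨h, ?_⟩⟩)
      refine hS y hyT x hx (fun j h1 h2 => ?_) hyS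
      rw [hy j (by omega) (by omega), hU h j (by omega) (by omega)]
    rw [key _ (cyl_subset_cyl c (by omega) le_rfl), key _ le_rfl]
    exact h p' hp' q' hq' c
  · have key : ∀ U ⊆ cyl c p' q', ν (U ∩ S) = 0 := by
      intro U hU
      refine measure_eq_zero_iff_ae_notMem.2 (hT.mono fun x hx hmem => hex ?_)
      exact ⟨x, hU hmem.1, hx, hmem.2⟩
    rw [key _ (cyl_subset_cyl c (by omega) le_rfl), key _ le_rfl]
    simp

lemma RightUniform.restrict (h : RightUniform E P ν p q) {S T : Set (ℤ → A)}
    (hSm : MeasurableSet S) (hTm : MeasurableSet T) (hT : ∀ᵐ x ∂ν, x ∈ T)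
    (hS : ∀ x ∈ T, ∀ y ∈ T, (∀ j, p ≤ j → j ≤ q → x j = y j) → x ∈ S → y ∈ S) :
    RightUniform E P (ν.restrict S) p q := by
  unfold RightUniform at *
  have hr : ∀ U : Set (ℤ → A), reflect ⁻¹' (reflect ⁻¹' U) = U := fun U => by
    ext x; simp [reflect_reflect]
  have e : (ν.restrict S).map reflect = (ν.map reflect).restrict (reflect ⁻¹' S) := by
    rw [Measure.restrict_map measurable_reflect (measurable_reflect hSm), hr]
  rw [e]
  refine LeftUniform.restrict h (T := reflect ⁻¹' T) ?_ ?_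
  · have : MeasurableSet {x | x ∈ reflect ⁻¹' T} := measurable_reflect hTm
    rw [ae_map_iff measurable_reflect.aemeasurable this]
    exact hT.mono fun x hx => by simpa [reflect_reflect] using hx
  · intro x hx y hy hxy hxS
    exact hS _ hx _ hy (fun j h1 h2 => hxy (-j) (by omega) (by omega)) hxS

lemma LeftUniform.sum {ι : Type*} {ν : ι → Measure (ℤ → A)}
    (h : ∀ i, LeftUniform E P (ν i) p q) : LeftUniform E P (Measure.sum ν) p q := by
  intro p' hp' q' hq' c
  rw [Measure.sum_apply _ (measurableSet_cyl _ _ _), Measure.sum_apply _ (measurableSet_cyl _ _ _),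
    ← ENNReal.tsum_mul_right]
  have := fun i => h i p' hp' q' hq' c
  simp only [this]
  split_ifs <;> simp

lemma RightUniform.sum {ι : Type*} {ν : ι → Measure (ℤ → A)}
    (h : ∀ i, RightUniform E P (ν i) p q) : RightUniform E P (Measure.sum ν) p q := by
  unfold RightUniform
  rw [Measure.map_sum measurable_reflect.aemeasurable]
  exact LeftUniform.sum h

lemma caMap_reflect (x : ℤ → A) :
    caMap (fun a b c => φ c b a) (reflect x) = reflect (caMap φ x) := by
  funext j
  simp only [caMap, reflect]
  congr 2 <;> ring

variable [Fintype A]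

lemma measurable_caMap (φ : A → A → A → A) : Measurable (caMap φ) := by
  refine measurable_pi_lambda _ fun j => ?_
  have h1 : Measurable fun x : ℤ → A => (x (j - 1), x j, x (j + 1)) :=
    (measurable_pi_apply _).prodMk ((measurable_pi_apply _).prodMk (measurable_pi_apply _))
  have h2 : Measurable fun y : A × A × A => φ y.1 y.2.1 y.2.2 := Measurable.of_discrete
  exact h2.comp h1

open Classical in
/-- The local condition under which a predecessor of `b` in a configuration continuing with
`b, c, d` determines, bijectively, the predecessor of the image of `c`. -/
def LeftBijective (φ : A → A → A → A) (E : A → A → Prop) (b c d : A) : Prop :=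
  ∀ s, {a | E a b ∧ φ a b c = s}.ncard = if E s (φ b c d) then 1 else 0

theorem LeftUniform.map_caMap (h : LeftUniform E P ν p q) (hpq : p + 1 < q)
    (hres : ∀ᵐ x ∂ν, ∀ j ≤ p, LeftBijective φ E (x j) (x (j + 1)) (x (j + 2))) :
    LeftUniform E P (ν.map (caMap φ)) (p + 1) (q - 1) := by
  classical
  intro p' hp' q' hq' d
  rw [Measure.map_apply (measurable_caMap φ) (measurableSet_cyl _ _ _),
    Measure.map_apply (measurable_caMap φ) (measurableSet_cyl _ _ _)]
  set k : ENNReal := if E (d (p' - 1)) (d p') then 1 else 0 with hk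
  suffices hS : ν (caMap φ ⁻¹' cyl d (p' - 1) q') * P = ν (caMap φ ⁻¹' cyl d p' q') * k by
    rw [hS, hk]; split_ifs <;> simp
  let f : (ℤ → A) → (Finset.Icc (p' - 1) (q' + 1) → A) := fun x j => x j
  have hf : Measurable f := measurable_pi_lambda _ fun _ => measurable_pi_apply _
  rw [measure_eq_sum_inter_fiber ν hf, measure_eq_sum_inter_fiber ν hf (caMap φ ⁻¹' cyl d p' q'),
    Finset.sum_mul, Finset.sum_mul]
  refine Finset.sum_congr rfl fun w _ => ?_
  by_cases h0 : ν (f ⁻¹' {w}) = 0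
  · rw [measure_mono_null Set.inter_subset_right h0, measure_mono_null Set.inter_subset_right h0,
      zero_mul, zero_mul]
  obtain ⟨e, hew, heres⟩ : ∃ e, e ∈ f ⁻¹' {w} ∧
      ∀ j ≤ p, LeftBijective φ E (e j) (e (j + 1)) (e (j + 2)) := by
    by_contra hne
    push Not at hne
    refine h0 (measure_eq_zero_iff_ae_notMem.2 (hres.mono fun x hx hmem => ?_))
    obtain ⟨j, hj, hj'⟩ := hne x hmem
    exact hj' (hx j hj)
  have hfib : f ⁻¹' {w} = cyl e (p' - 1) (q' + 1) := by
    have : f e = w := hew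
    rw [← this]
    ext x
    simp only [Set.mem_preimage, Set.mem_singleton_iff, cyl, Set.mem_ofPred_eq, funext_iff, f]
    exact ⟨fun h j h1 h2 => h ⟨j, Finset.mem_Icc.2 ⟨h1, h2⟩⟩,
      fun h j => h j (Finset.mem_Icc.1 j.2).1 (Finset.mem_Icc.1 j.2).2⟩
  rw [hfib]
  have hcong : ∀ x ∈ cyl e (p' - 1) (q' + 1), ∀ j, p' ≤ j → j ≤ q' →
      caMap φ x j = caMap φ e j := by
    intro x hx j h1 h2
    simp only [caMap]
    rw [hx (j - 1) (by omega) (by omega), hx j (by omega) (by omega),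
      hx (j + 1) (by omega) (by omega)]
  by_cases heT : e ∈ caMap φ ⁻¹' cyl d p' q'
  swap
  · have hT : caMap φ ⁻¹' cyl d p' q' ∩ cyl e (p' - 1) (q' + 1) = ∅ := by
      refine Set.eq_empty_of_forall_notMem fun x hx => heT fun j h1 h2 => ?_
      rw [← hcong x hx.2 j h1 h2, hx.1 j h1 h2]
    have hS : caMap φ ⁻¹' cyl d (p' - 1) q' ∩ cyl e (p' - 1) (q' + 1) = ∅ := by
      refine Set.subset_eq_empty ?_ hT
      exact Set.inter_subset_inter_left _ (Set.preimage_mono (cyl_subset_cyl d (by omega) le_rfl))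
    rw [hT, hS]
    simp
  have hT : caMap φ ⁻¹' cyl d p' q' ∩ cyl e (p' - 1) (q' + 1) = cyl e (p' - 1) (q' + 1) := by
    refine Set.inter_eq_right.2 fun x hx j h1 h2 => ?_
    rw [hcong x hx j h1 h2, heT j h1 h2]
  rw [hT, measure_eq_sum_inter_fiber ν (measurable_pi_apply (p' - 2)), Finset.sum_mul]
  have hterm : ∀ a : A, ν (caMap φ ⁻¹' cyl d (p' - 1) q' ∩ cyl e (p' - 1) (q' + 1) ∩
      (fun x : ℤ → A => x (p' - 2)) ⁻¹' {a}) * P =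
      if E a (e (p' - 1)) ∧ φ a (e (p' - 1)) (e p') = d (p' - 1) then
        ν (cyl e (p' - 1) (q' + 1)) else 0 := by
    intro a
    have hupd : ∀ j, p' - 1 ≤ j → Function.update e (p' - 2) a j = e j := fun j hj =>
      Function.update_of_ne (by omega) _ _
    by_cases hφ : φ a (e (p' - 1)) (e p') = d (p' - 1)
    · have hset : caMap φ ⁻¹' cyl d (p' - 1) q' ∩ cyl e (p' - 1) (q' + 1) ∩
          (fun x : ℤ → A => x (p' - 2)) ⁻¹' {a} =
          cyl (Function.update e (p' - 2) a) (p' - 1 - 1) (q' + 1) := by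
        ext x
        constructor
        · rintro ⟨⟨-, h2⟩, h3⟩ j h4 h5
          rcases (show j = p' - 2 ∨ p' - 1 ≤ j by omega) with rfl | h6
          · rw [Function.update_self]; exact h3
          · rw [hupd j h6]; exact h2 j h6 h5
        · intro hx
          have hx1 : x ∈ cyl e (p' - 1) (q' + 1) := fun j h1 h2 => by
            rw [← hupd j h1]; exact hx j (by omega) h2
          have hx2 : x (p' - 2) = a := by
            rw [hx _ (by omega) (by omega), Function.update_self]
          refine ⟨⟨fun j h1 h2 => ?_, hx1⟩, hx2⟩
          rcases (show j = p' - 1 ∨ p' ≤ j by omega) with rfl | h6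
          · rw [← hφ, caMap, show p' - 1 - 1 = p' - 2 by ring, show p' - 1 + 1 = p' by ring, hx2,
              hx1 _ (by omega) (by omega), hx1 _ (by omega) (by omega)]
          · rw [hcong x hx1 j h6 h2, heT j h6 h2]
      have huni := h (p' - 1) (by omega) (q' + 1) (by omega) (Function.update e (p' - 2) a)
      rw [hset, huni, hupd _ le_rfl, show p' - 1 - 1 = p' - 2 by ring, Function.update_self]
      simp only [hφ, and_true]
      congr 2
      ext x
      simp only [cyl, Set.mem_ofPred_eq]
      refine forall_congr' fun j => forall_congr' fun h1 => ?_
      rw [hupd j h1]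
    · rw [if_neg (fun hh => hφ hh.2)]
      have hset : caMap φ ⁻¹' cyl d (p' - 1) q' ∩ cyl e (p' - 1) (q' + 1) ∩
          (fun x : ℤ → A => x (p' - 2)) ⁻¹' {a} = ∅ := by
        refine Set.eq_empty_of_forall_notMem fun x hx => hφ ?_
        obtain ⟨⟨h1, h2⟩, h3⟩ := hx
        have h4 := h1 (p' - 1) le_rfl (by omega)
        have h5 : x (p' - 2) = a := h3
        rw [caMap, show p' - 1 - 1 = p' - 2 by ring, show p' - 1 + 1 = p' by ring, h5,
          h2 _ (by omega) (by omega), h2 _ (by omega) (by omega)] at h4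
        exact h4
      rw [hset]
      simp
  simp only [hterm]
  rw [← Finset.sum_filter, Finset.sum_const]
  have hc := heres (p' - 1) (by omega) (d (p' - 1))
  rw [show p' - 1 + 1 = p' by ring, show p' - 1 + 2 = p' + 1 by ring] at hc
  have hdp : φ (e (p' - 1)) (e p') (e (p' + 1)) = d p' := heT p' le_rfl (by omega)
  rw [hdp] at hc
  have hc2 : (Finset.univ.filter fun a => E a (e (p' - 1)) ∧
      φ a (e (p' - 1)) (e p') = d (p' - 1)).card = if E (d (p' - 1)) (d p') then 1 else 0 := by
    rw [← hc, Set.ncard_eq_toFinset_card']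
    congr 1
    ext
    simp
  rw [hc2, hk]
  split_ifs <;> simp

theorem RightUniform.map_caMap (h : RightUniform E P ν p q) (hpq : p + 1 < q)
    (hres : ∀ᵐ x ∂ν, ∀ j ≥ q, LeftBijective (fun a b c => φ c b a) (fun a b => E b a)
      (x j) (x (j - 1)) (x (j - 2))) :
    RightUniform E P (ν.map (caMap φ)) (p + 1) (q - 1) := by
  unfold RightUniform at *
  have e : (ν.map (caMap φ)).map reflect =
      (ν.map reflect).map (caMap fun a b c => φ c b a) := by
    rw [Measure.map_map measurable_reflect (measurable_caMap _),
      Measure.map_map (measurable_caMap _) measurable_reflect]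
    congr 1
    funext x
    exact (caMap_reflect x).symm
  rw [e]
  have hm : MeasurableSet {x : ℤ → A | ∀ j ≤ -q, LeftBijective (fun a b c => φ c b a)
      (fun a b => E b a) (x j) (x (j + 1)) (x (j + 2))} := by
    rw [Set.ofPred_forall]
    refine MeasurableSet.iInter fun j => ?_
    rw [Set.ofPred_forall]
    refine MeasurableSet.iInter fun _ => ?_
    have h1 : Measurable fun x : ℤ → A => (x j, x (j + 1), x (j + 2)) :=
      (measurable_pi_apply _).prodMk ((measurable_pi_apply _).prodMk (measurable_pi_apply _))
    have h2 : MeasurableSet {y : A × A × A | LeftBijective (fun a b c => φ c b a)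
      (fun a b => E b a) y.1 y.2.1 y.2.2} := MeasurableSet.of_discrete
    exact h1 h2
  have := LeftUniform.map_caMap (φ := fun a b c => φ c b a) h (by omega) (by
    rw [ae_map_iff measurable_reflect.aemeasurable hm]
    refine hres.mono fun x hx j hj => ?_
    have := hx (-j) (by omega)
    simp only [reflect]
    rwa [show -(j + 1) = -j - 1 by ring, show -(j + 2) = -j - 2 by ring])
  exact this.mono (by omega) (by omega)

/-- The mass of a cylinder reaching two cells beyond `[p, q]` on either side. -/
theorem measure_cyl_two_steps {E' : A → A → Prop} {F : ℕ} (hl : LeftUniform E P ν p q)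
    (hr : RightUniform E' F ν p q) (c : ℤ → A) :
    ν (cyl c (p - 2) (q + 2)) * (P ^ 2 * F ^ 2 : ENNReal) =
      (open Classical in if E (c (p - 2)) (c (p - 1)) ∧ E (c (p - 1)) (c p) ∧ E' (c q) (c (q + 1)) ∧
        E' (c (q + 1)) (c (q + 2)) then 1 else 0) * ν (cyl c p q) := by
  classical
  rw [rightUniform_iff] at hr
  have h1 := hl (p - 1) (by omega) (q + 2) (by omega) c
  have h2 := hl p le_rfl (q + 2) (by omega) c
  have h3 := hr p le_rfl (q + 1) (by omega) c
  have h4 := hr p le_rfl q le_rfl c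
  rw [show p - 1 - 1 = p - 2 by ring] at h1
  rw [show q + 1 + 1 = q + 2 by ring] at h3
  calc _ = ν (cyl c (p - 2) (q + 2)) * P * P * F * F := by ring
    _ = _ := by
      rw [h1]
      by_cases c1 : E (c (p - 2)) (c (p - 1))
      swap
      · simp [c1]
      by_cases c2 : E (c (p - 1)) (c p)
      swap
      · simp [c1, c2, h2]
      by_cases c3 : E' (c (q + 1)) (c (q + 2))
      swap
      · simp [c1, c2, c3, h2, h3]
      by_cases c4 : E' (c q) (c (q + 1)) <;> simp [c1, c2, c3, c4, h2, h3, h4]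

end Uniform

/-! ### The initial measure -/

section Initial

variable {A : Type*} [MeasurableSpace A]

lemma measurable_glue (W : ℕ) : Measurable (glue (A := A) W) := by
  refine measurable_pi_lambda _ fun j => ?_
  unfold glue
  split_ifs
  · exact (measurable_pi_apply _).comp measurable_fst
  · exact (measurable_pi_apply _).comp (measurable_snd.comp measurable_snd)
  · exact (measurable_pi_apply _).comp (measurable_fst.comp measurable_snd)

lemma glue_preimage_cyl (W : ℕ) (c : ℤ → A) {p q : ℤ} (hp : p ≤ -extL W) (hq : extR W ≤ q) :
    glue W ⁻¹' cyl c p q = cyl (translate (-extL W) c) (p + extL W) (-1) ×ˢ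
      ({d : Fin W → A | ∀ i : Fin W, d i = c ((i : ℕ) - extL W)} ×ˢ
        cyl (translate (extR W) c) 1 (q - extR W)) := by
  have hW : extL W + extR W + 1 = W := by unfold extL extR; omega
  ext ⟨l, d, r⟩
  simp only [Set.mem_preimage, Set.mem_prod, cyl, Set.mem_ofPred_eq, translate]
  constructor
  · intro h
    refine ⟨fun j h1 h2 => ?_, fun i => ?_, fun j h1 h2 => ?_⟩
    · have := h (j + -extL W) (by omega) (by omega)
      rw [glue, dif_pos (by omega)] at this
      simpa using this
    · have hi := i.2
      have := h ((i : ℕ) - extL W) (by omega) (by omega)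
      rw [glue, dif_neg (by omega), dif_neg (by omega)] at this
      simpa using this
    · have := h (j + extR W) (by omega) (by omega)
      rw [glue, dif_neg (by omega), dif_pos (by omega)] at this
      simpa using this
  · rintro ⟨h1, h2, h3⟩ j h4 h5
    unfold glue
    split_ifs with h6 h7
    · have := h1 (j + extL W) (by omega) (by omega)
      simpa using this
    · have := h3 (j - extR W) (by omega) (by omega)
      simpa using this
    · refine (h2 _).trans ?_
      congr 1
      simp only
      omega

variable [MeasurableSingletonClass A] {lam rho : Measure (ℤ → A)} {W : ℕ}
  {del : Measure (Fin W → A)} [IsProbabilityMeasure lam] [IsProbabilityMeasure rho]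
  [IsProbabilityMeasure del]

lemma initialMeasure_cyl (c : ℤ → A) {p q : ℤ} (hp : p ≤ -extL W) (hq : extR W ≤ q) :
    initialMeasure W lam del rho (cyl c p q) =
      lam (cyl (translate (-extL W) c) (p + extL W) (-1)) *
        (del {d : Fin W → A | ∀ i : Fin W, d i = c ((i : ℕ) - extL W)} *
          rho (cyl (translate (extR W) c) 1 (q - extR W))) := by
  rw [initialMeasure, Measure.map_apply (measurable_glue W) (measurableSet_cyl _ _ _),
    glue_preimage_cyl W c hp hq, Measure.prod_prod, Measure.prod_prod]

lemma leftUniform_initialMeasure {E : A → A → Prop} {P : ℕ} (h : LeftUniform E P lam (-1) (-1)) :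
    LeftUniform E P (initialMeasure W lam del rho) (-extL W - 1) (extR W + 1) := by
  intro p hp q hq c
  rw [initialMeasure_cyl c (by omega) (by omega), initialMeasure_cyl c (by omega) (by omega)]
  have := h (p + extL W) (by omega) (-1) le_rfl (translate (-extL W) c)
  have e1 : translate (-extL W) c (p + extL W - 1) = c (p - 1) := by
    simp only [translate]; congr 1; ring
  have e2 : translate (-extL W) c (p + extL W) = c p := by simp [translate]
  rw [e1, e2] at this
  rw [show p - 1 + extL W = p + extL W - 1 by ring, mul_right_comm, this]
  split_ifs <;> simp

lemma rightUniform_initialMeasure {E : A → A → Prop} {P : ℕ} (h : RightUniform E P rho 1 1) :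
    RightUniform E P (initialMeasure W lam del rho) (-extL W - 1) (extR W + 1) := by
  rw [rightUniform_iff] at *
  intro p hp q hq c
  rw [initialMeasure_cyl c (by omega) (by omega), initialMeasure_cyl c (by omega) (by omega)]
  have := h 1 le_rfl (q - extR W) (by omega) (translate (extR W) c)
  have e1 : translate (extR W) c (q - extR W + 1) = c (q + 1) := by
    simp only [translate]; congr 1; ring
  have e2 : translate (extR W) c (q - extR W) = c q := by simp [translate]
  rw [e1, e2] at this
  rw [show q + 1 - extR W = q - extR W + 1 by ring, mul_assoc, mul_assoc, this]
  split_ifs <;> simp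

end Initial

/-! ### Measurability of the defect location -/

lemma measurable_sInf_int {Ω : Type*} [MeasurableSpace Ω] {B : Ω → Set ℤ}
    (hB : ∀ j, Measurable fun x => j ∈ B x) : Measurable fun x => sInf (B x) := by
  have hl : ∀ i, Measurable fun x => IsLeast (B x) i := fun i =>
    (hB i).and (Measurable.forall fun j => (hB j).imp measurable_const)
  refine measurable_to_countable' fun y => ?_
  have : (fun x => sInf (B x)) ⁻¹' {y} =
      {x | IsLeast (B x) y ∨ (y = 0 ∧ ¬ ∃ i, IsLeast (B x) i)} := by
    ext x
    change sInf (B x) = y ↔ _ ∨ _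
    by_cases h : ∃ i, IsLeast (B x) i
    · obtain ⟨i, hi⟩ := h
      rw [hi.csInf_eq]
      constructor
      · rintro rfl
        exact Or.inl hi
      · rintro (h1 | ⟨-, h1⟩)
        · exact hi.unique h1
        · exact absurd ⟨i, hi⟩ h1
    · have h0 : sInf (B x) = 0 := by
        rcases (B x).eq_empty_or_nonempty with h1 | h1
        · rw [h1]; exact Int.csInf_empty
        · refine Int.csInf_of_not_bddBelow fun h2 => h ⟨_, Int.csInf_mem h1 h2, fun j hj => ?_⟩
          exact csInf_le h2 hj
      rw [h0]
      constructor
      · rintro rfl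
        exact Or.inr ⟨rfl, h⟩
      · rintro (h1 | ⟨h1, -⟩)
        · exact absurd ⟨y, h1⟩ h
        · exact h1.symm
  rw [this, measurableSet_setOfPred]
  exact (hl y).or (measurable_const.and (Measurable.exists hl).not)

lemma measurable_sSup_int {Ω : Type*} [MeasurableSpace Ω] {B : Ω → Set ℤ}
    (hB : ∀ j, Measurable fun x => j ∈ B x) : Measurable fun x => sSup (B x) := by
  have hl : ∀ i, Measurable fun x => IsGreatest (B x) i := fun i =>
    (hB i).and (Measurable.forall fun j => (hB j).imp measurable_const)
  refine measurable_to_countable' fun y => ?_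
  have : (fun x => sSup (B x)) ⁻¹' {y} =
      {x | IsGreatest (B x) y ∨ (y = 0 ∧ ¬ ∃ i, IsGreatest (B x) i)} := by
    ext x
    change sSup (B x) = y ↔ _ ∨ _
    by_cases h : ∃ i, IsGreatest (B x) i
    · obtain ⟨i, hi⟩ := h
      rw [hi.csSup_eq]
      constructor
      · rintro rfl
        exact Or.inl hi
      · rintro (h1 | ⟨-, h1⟩)
        · exact hi.unique h1
        · exact absurd ⟨i, hi⟩ h1
    · have h0 : sSup (B x) = 0 := by
        rcases (B x).eq_empty_or_nonempty with h1 | h1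
        · rw [h1]; exact Int.csSup_empty
        · refine Int.csSup_of_not_bddAbove fun h2 => h ⟨_, Int.csSup_mem h1 h2, fun j hj => ?_⟩
          exact le_csSup h2 hj
      rw [h0]
      constructor
      · rintro rfl
        exact Or.inr ⟨rfl, h⟩
      · rintro (h1 | ⟨h1, -⟩)
        · exact absurd ⟨y, h1⟩ h
        · exact h1.symm
  rw [this, measurableSet_setOfPred]
  exact (hl y).or (measurable_const.and (Measurable.exists hl).not)

section Measurability

variable {A : Type*} [Fintype A] [MeasurableSpace A] [MeasurableSingletonClass A]

lemma measurable_rel (E : A → A → Prop) (i j : ℤ) :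
    Measurable fun x : ℤ → A => E (x i) (x j) := by
  have h1 : Measurable fun x : ℤ → A => (x i, x j) :=
    (measurable_pi_apply _).prodMk (measurable_pi_apply _)
  have h2 : Measurable fun y : A × A => E y.1 y.2 := Measurable.of_discrete
  exact h2.comp h1

lemma measurable_mem_badSet (S : Set (ℤ → A)) (j : ℤ) :
    Measurable fun x : ℤ → A => j ∈ badSet S x :=
  measurable_rel (fun a b => ¬ Adm S a b) j (j + 1)

lemma measurable_centre (S : Set (ℤ → A)) : Measurable (centre S) := by
  have h1 := measurable_sInf_int (measurable_mem_badSet S)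
  have h2 := measurable_sSup_int (measurable_mem_badSet S)
  have h3 : Measurable fun n : ℤ => (n + 1) / 2 := Measurable.of_discrete
  exact h3.comp (h1.add h2)

lemma measurable_translate_comp {Ω : Type*} [MeasurableSpace Ω] {g : Ω → ℤ} {f : Ω → ℤ → A}
    (hg : Measurable g) (hf : Measurable f) : Measurable fun x => translate (g x) (f x) := by
  have h : Measurable fun y : ℤ × (ℤ → A) => translate y.1 y.2 :=
    measurable_from_prod_countable_right fun v => measurable_translate v
  exact h.comp (hg.prodMk hf)

end Measurability

/-! ### The configuration seen from the unit-speed follower -/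

section Dynamics

variable {A : Type*} {φ : A → A → A → A} {L R S : Set (ℤ → A)} {W : ℕ} {x y : ℤ → A}

/-- The configuration seen from its defect. -/
def recentre (S : Set (ℤ → A)) (x : ℤ → A) : ℤ → A := translate (centre S x) x

/-- One step of the automaton, followed by a step of the observer towards the defect. -/
def followStep (φ : A → A → A → A) (S : Set (ℤ → A)) (x : ℤ → A) : ℤ → A :=
  translate (centre S (caMap φ x)).sign (caMap φ x)

/-- A reformulation of `HasDefect` by admissibility of transitions. -/
def TameDefect (L R : Set (ℤ → A)) (W : ℕ) (x : ℤ → A) : Prop :=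
  (∃ i k : ℤ, IsLeast (badSet (L ∪ R) x) i ∧ IsGreatest (badSet (L ∪ R) x) k ∧ k - i ≤ W) ∧
  (∀ j, j + 1 < centre (L ∪ R) x - extL W → Adm L (x j) (x (j + 1))) ∧
  (∀ j, centre (L ∪ R) x + extR W < j → Adm R (x j) (x (j + 1)))

def Tame (φ : A → A → A → A) (L R : Set (ℤ → A)) (W : ℕ) : Set (ℤ → A) :=
  {x | ∀ t : ℕ, TameDefect L R W ((caMap φ)^[t] x)}

/-- Configurations whose defect is persistent and, at present, close to the origin. -/
def Tracked (φ : A → A → A → A) (L R : Set (ℤ → A)) (W : ℕ) : Set (ℤ → A) :=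
  {x | x ∈ Tame φ L R W ∧ ∀ j ∈ badSet (L ∪ R) x, -(extL W + 1) ≤ j ∧ j ≤ extR W}

lemma HasDefect.tameDefect (hL : IsMarkovSubshift L) (hR : IsMarkovSubshift R)
    (h : HasDefect L R W x) : TameDefect L R W x := by
  obtain ⟨h1, ⟨l, hl, hlx⟩, ⟨r, hr, hrx⟩⟩ := h
  refine ⟨h1, fun j hj => ?_, fun j hj => ?_⟩
  · rw [← hlx j (by omega), ← hlx (j + 1) hj]
    exact hL.adm hl j
  · rw [← hrx j hj, ← hrx (j + 1) (by omega)]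
    exact hR.adm hr j

lemma particles_subset_tame (hL : IsMarkovSubshift L) (hR : IsMarkovSubshift R) :
    particles φ L R W ⊆ Tame φ L R W := fun _ hx t => (hx t).tameDefect hL hR

lemma mem_badSet_translate (v j : ℤ) :
    j ∈ badSet S (translate v x) ↔ j + v ∈ badSet S x := by
  change ¬ Adm S (x (j + v)) (x (j + 1 + v)) ↔ ¬ Adm S (x (j + v)) (x (j + v + 1))
  rw [add_right_comm]

lemma isLeast_badSet_translate {i : ℤ} (h : IsLeast (badSet S x) i) (v : ℤ) :
    IsLeast (badSet S (translate v x)) (i - v) := by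
  refine ⟨(mem_badSet_translate v _).2 (by simpa using h.1), fun j hj => ?_⟩
  have := h.2 ((mem_badSet_translate v j).1 hj)
  omega

lemma isGreatest_badSet_translate {i : ℤ} (h : IsGreatest (badSet S x) i) (v : ℤ) :
    IsGreatest (badSet S (translate v x)) (i - v) := by
  refine ⟨(mem_badSet_translate v _).2 (by simpa using h.1), fun j hj => ?_⟩
  have := h.2 ((mem_badSet_translate v j).1 hj)
  omega

lemma centre_eq {i k : ℤ} (hi : IsLeast (badSet S x) i) (hk : IsGreatest (badSet S x) k) :
    centre S x = (i + k + 1) / 2 := by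
  rw [centre, hi.csInf_eq, hk.csSup_eq]

lemma centre_translate {i k : ℤ} (hi : IsLeast (badSet S x) i) (hk : IsGreatest (badSet S x) k)
    (v : ℤ) : centre S (translate v x) = centre S x - v := by
  rw [centre_eq hi hk,
    centre_eq (isLeast_badSet_translate hi v) (isGreatest_badSet_translate hk v)]
  omega

lemma TameDefect.centre_translate (h : TameDefect L R W x) (v : ℤ) :
    centre (L ∪ R) (translate v x) = centre (L ∪ R) x - v := by
  obtain ⟨⟨i, k, hi, hk, -⟩, -⟩ := h
  exact DefectCA.centre_translate hi hk v

lemma TameDefect.translate (h : TameDefect L R W x) (v : ℤ) :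
    TameDefect L R W (translate v x) := by
  have hc := h.centre_translate v
  obtain ⟨⟨i, k, hi, hk, hik⟩, h2, h3⟩ := h
  refine ⟨⟨i - v, k - v, isLeast_badSet_translate hi v, isGreatest_badSet_translate hk v,
    by omega⟩, fun j hj => ?_, fun j hj => ?_⟩
  · have := h2 (j + v) (by omega)
    rwa [add_right_comm] at this
  · have := h3 (j + v) (by omega)
    rwa [add_right_comm] at this

lemma caMap_translate (v : ℤ) (x : ℤ → A) :
    caMap φ (translate v x) = translate v (caMap φ x) := by
  funext j
  simp only [caMap, translate]
  congr 2 <;> ring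

lemma caMap_iterate_translate (v : ℤ) (t : ℕ) (x : ℤ → A) :
    (caMap φ)^[t] (translate v x) = translate v ((caMap φ)^[t] x) := by
  have h : Function.Semiconj (translate v) (caMap φ) (caMap φ) := fun x =>
    (caMap_translate v x).symm
  exact ((h.iterate_right t).eq x).symm

lemma Tame.translate (h : x ∈ Tame φ L R W) (v : ℤ) : translate v x ∈ Tame φ L R W := fun t => by
  rw [caMap_iterate_translate]
  exact (h t).translate v

lemma Tame.caMap (h : x ∈ Tame φ L R W) : caMap φ x ∈ Tame φ L R W := fun t => by
  have := h (t + 1)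
  rwa [Function.iterate_succ_apply] at this

lemma mapsTo_union (hL : Set.MapsTo (caMap φ) L L) (hR : Set.MapsTo (caMap φ) R R) :
    Set.MapsTo (caMap φ) (L ∪ R) (L ∪ R) := fun _ hx => hx.imp (fun h => hL h) (fun h => hR h)

/-- The inadmissible transitions spread at unit speed. -/
lemma badSet_caMap (hS : IsMarkovSubshift S) (hφ : Set.MapsTo (caMap φ) S S) {i k j : ℤ}
    (hi : i ∈ lowerBounds (badSet S x)) (hk : k ∈ upperBounds (badSet S x))
    (hj : j ∈ badSet S (caMap φ x)) : i - 1 ≤ j ∧ j ≤ k + 1 := by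
  by_contra hne
  refine hj ?_
  obtain ⟨s, hs, hsx⟩ := hS.exists_extension (x := x) (p := j - 1) (q := j + 2) (by omega) (by
    intro n h1 h2
    by_contra hn
    have h3 := hi hn
    have h4 := hk hn
    omega)
  have := hS.adm (hφ hs) j
  simp only [DefectCA.caMap] at this ⊢
  rwa [hsx _ (by omega) (by omega), hsx _ (by omega) (by omega), hsx _ (by omega) (by omega),
    hsx _ (by omega) (by omega), hsx _ (by omega) (by omega)] at this

lemma recentre_mem_tracked (h : x ∈ Tame φ L R W) : recentre (L ∪ R) x ∈ Tracked φ L R W := by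
  refine ⟨Tame.translate h _, fun j hj => ?_⟩
  obtain ⟨⟨i, k, hi, hk, hik⟩, -⟩ := h 0
  rw [Function.iterate_zero, id] at hi hk
  rw [recentre, mem_badSet_translate, centre_eq hi hk] at hj
  have h1 := hi.2 hj
  have h2 := hk.2 hj
  unfold extL extR
  omega

lemma followStep_mem_tracked (hS : IsMarkovSubshift (L ∪ R))
    (hφ : Set.MapsTo (caMap φ) (L ∪ R) (L ∪ R)) (h : x ∈ Tracked φ L R W) :
    followStep φ (L ∪ R) x ∈ Tracked φ L R W := by
  obtain ⟨ht, hb⟩ := h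
  refine ⟨Tame.translate (Tame.caMap ht) _, fun j hj => ?_⟩
  obtain ⟨⟨i, k, hi, hk, hik⟩, -⟩ := Tame.caMap ht 0
  rw [Function.iterate_zero, id] at hi hk
  have h3 := badSet_caMap hS hφ (fun n hn => (hb n hn).1) (fun n hn => (hb n hn).2) hi.1
  have h4 := badSet_caMap hS hφ (fun n hn => (hb n hn).1) (fun n hn => (hb n hn).2) hk.1
  rw [followStep, mem_badSet_translate] at hj
  have h1 := hi.2 hj
  have h2 := hk.2 hj
  have hc := centre_eq hi hk
  unfold extL extR at *
  rcases lt_trichotomy (centre (L ∪ R) (caMap φ x)) 0 with h0 | h0 | h0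
  · rw [Int.sign_eq_neg_one_of_neg h0] at h1 h2
    omega
  · rw [h0, Int.sign_zero] at h1 h2
    omega
  · rw [Int.sign_eq_one_of_pos h0] at h1 h2
    omega

lemma iterate_followStep (h : x ∈ Tame φ L R W) (t : ℕ) :
    (followStep φ (L ∪ R))^[t] (recentre (L ∪ R) x) =
      translate (follower (trajectory φ (L ∪ R) x) t) ((caMap φ)^[t] x) := by
  induction t with
  | zero => rfl
  | succ t ih =>
    rw [Function.iterate_succ_apply', ih, followStep, caMap_translate,
      ← Function.iterate_succ_apply' (caMap φ), (h (t + 1)).centre_translate, translate_translate]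
    congr 1
    rw [follower, trajectory, add_comm]

/-- The pattern within distance `K` of the origin. -/
def window (K : ℕ) (x : ℤ → A) : Set.Icc (-(K : ℤ)) K → A := fun j => x j

lemma localState_eq (h : x ∈ Tame φ L R W) (K t : ℕ) :
    localState φ (L ∪ R) K x t =
      window K ((followStep φ (L ∪ R))^[t] (recentre (L ∪ R) x)) := by
  rw [iterate_followStep h]
  funext j
  simp only [localState, window, translate, add_comm]

lemma trajectory_succ_sub (h : x ∈ Tame φ L R W) (t : ℕ) :
    trajectory φ (L ∪ R) x (t + 1) = trajectory φ (L ∪ R) x t +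
      (centre (L ∪ R) (caMap φ ((followStep φ (L ∪ R))^[t] (recentre (L ∪ R) x))) -
        centre (L ∪ R) ((followStep φ (L ∪ R))^[t] (recentre (L ∪ R) x))) := by
  rw [iterate_followStep h, caMap_translate, ← Function.iterate_succ_apply' (caMap φ),
    (h (t + 1)).centre_translate, (h t).centre_translate, trajectory, trajectory]
  ring

lemma window_eq_iff {K : ℕ} :
    window K x = window K y ↔ ∀ j, -(K : ℤ) ≤ j → j ≤ K → x j = y j := by
  simp only [window, funext_iff]
  exact ⟨fun h j h1 h2 => h ⟨j, h1, h2⟩, fun h j => h j j.2.1 j.2.2⟩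

lemma badSet_subset_of_agree {p q : ℤ} (h : ∀ j ∈ badSet S x, p ≤ j ∧ j < q)
    (hxy : ∀ j, p ≤ j → j ≤ q → x j = y j) : badSet S x ⊆ badSet S y := by
  intro j hj
  have h1 := h j hj
  change ¬ Adm S (y j) (y (j + 1))
  rw [← hxy j (by omega) (by omega), ← hxy (j + 1) (by omega) (by omega)]
  exact hj

lemma centre_eq_of_agree {p q : ℤ} (hx : ∀ j ∈ badSet S x, p ≤ j ∧ j < q)
    (hy : ∀ j ∈ badSet S y, p ≤ j ∧ j < q) (hxy : ∀ j, p ≤ j → j ≤ q → x j = y j) :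
    centre S x = centre S y := by
  have : badSet S x = badSet S y := Set.Subset.antisymm (badSet_subset_of_agree hx hxy)
    (badSet_subset_of_agree hy fun j h1 h2 => (hxy j h1 h2).symm)
  rw [centre, centre, this]

lemma centre_eq_of_window {K : ℕ} (hK : W + 3 ≤ K) (hx : x ∈ Tracked φ L R W)
    (hy : y ∈ Tracked φ L R W) (h : window K x = window K y) :
    centre (L ∪ R) x = centre (L ∪ R) y := by
  rw [window_eq_iff] at h
  refine centre_eq_of_agree (p := -K) (q := K) (fun j hj => ?_) (fun j hj => ?_) h
  · have := hx.2 j hj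
    unfold extL extR at this
    omega
  · have := hy.2 j hj
    unfold extL extR at this
    omega

lemma centre_caMap_eq_of_window (hS : IsMarkovSubshift (L ∪ R))
    (hφ : Set.MapsTo (caMap φ) (L ∪ R) (L ∪ R)) {K : ℕ} (hK : W + 3 ≤ K)
    (hx : x ∈ Tracked φ L R W) (hy : y ∈ Tracked φ L R W) (h : window K x = window K y) :
    centre (L ∪ R) (caMap φ x) = centre (L ∪ R) (caMap φ y) := by
  rw [window_eq_iff] at h
  have key : ∀ z ∈ Tracked φ L R W, ∀ j ∈ badSet (L ∪ R) (caMap φ z),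
      -(K : ℤ) + 1 ≤ j ∧ j < (K : ℤ) - 1 := by
    intro z hz j hj
    have := badSet_caMap hS hφ (fun n hn => (hz.2 n hn).1) (fun n hn => (hz.2 n hn).2) hj
    unfold extL extR at this
    omega
  refine centre_eq_of_agree (key x hx) (key y hy) fun j h1 h2 => ?_
  rw [caMap, caMap, h _ (by omega) (by omega), h _ (by omega) (by omega),
    h _ (by omega) (by omega)]

lemma Tracked.adm_left {K : ℕ} (hK : W + 3 ≤ K) (h : x ∈ Tracked φ L R W) {j : ℤ}
    (hj : j ≤ -K + 1) : Adm L (x j) (x (j + 1)) := by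
  obtain ⟨ht, hb⟩ := h
  obtain ⟨⟨i, k, hi, hk, hik⟩, h2, -⟩ := ht 0
  rw [Function.iterate_zero, id] at *
  refine h2 j ?_
  rw [centre_eq hi hk]
  have h3 := hb i hi.1
  have h4 := hk.2 hi.1
  unfold extL extR at *
  omega

lemma Tracked.adm_right {K : ℕ} (hK : W + 3 ≤ K) (h : x ∈ Tracked φ L R W) {j : ℤ}
    (hj : K - 2 ≤ j) : Adm R (x j) (x (j + 1)) := by
  obtain ⟨ht, hb⟩ := h
  obtain ⟨⟨i, k, hi, hk, hik⟩, -, h2⟩ := ht 0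
  rw [Function.iterate_zero, id] at *
  refine h2 j ?_
  rw [centre_eq hi hk]
  have h3 := hb k hk.1
  have h4 := hi.2 hk.1
  unfold extL extR at *
  omega

end Dynamics

section Bijective

variable {A : Type*} [Fintype A] {φ : A → A → A → A} {S : Set (ℤ → A)}

lemma ncard_fiber_eq {f : A → A} {T U : Set A} (hmaps : Set.MapsTo f T U) (hinj : Set.InjOn f T)
    (hcard : U.ncard ≤ T.ncard) (s : A) [Decidable (s ∈ U)] :
    {a | a ∈ T ∧ f a = s}.ncard = if s ∈ U then 1 else 0 := by
  have himg : f '' T = U := Set.eq_of_subset_of_ncard_le hmaps.image_subset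
    (by rwa [hinj.ncard_image]) (Set.toFinite _)
  split_ifs with hs
  · obtain ⟨a, ha, rfl⟩ := himg ▸ hs
    rw [Set.ncard_eq_one]
    refine ⟨a, ?_⟩
    ext b
    exact ⟨fun hb => hinj hb.1 ha hb.2, fun hb => by rw [hb]; exact ⟨ha, rfl⟩⟩
  · rw [Set.ncard_eq_zero (Set.toFinite _)]
    refine Set.eq_empty_of_forall_notMem fun a ha => hs ?_
    rw [← ha.2]
    exact hmaps ha.1

lemma exists_mem_of_adm_adm (hS : IsMarkovSubshift S) {b c d : A} (h1 : Adm S b c)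
    (h2 : Adm S c d) : ∃ s ∈ S, s 0 = b ∧ s 1 = c ∧ s 2 = d := by
  obtain ⟨s, hs, hsx⟩ := hS.exists_extension (p := 0) (q := 2)
    (x := fun j => if j = 0 then b else if j = 1 then c else d) (by omega) (by
      intro j h3 h4
      rcases (show j = 0 ∨ j = 1 by omega) with rfl | rfl
      · simpa using h1
      · simpa using h2)
  refine ⟨s, hs, ?_, ?_, ?_⟩
  · simpa using hsx 0 le_rfl (by omega)
  · simpa using hsx 1 (by omega) (by omega)
  · simpa using hsx 2 (by omega) le_rfl

lemma mem_words_three {s : ℤ → A} (hs : s ∈ S) : ![s 0, s 1, s 2] ∈ words S 3 :=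
  ⟨s, hs, fun i => by fin_cases i <;> rfl⟩

lemma leftBijective_of_adm (hS : IsMarkovSubshift S) (hφ : Set.MapsTo (caMap φ) S S) {P : ℕ}
    (hP : ∀ b ∈ symbols S, (pred S b).ncard = P) (hres : LeftResolving φ S) {b c d : A}
    (h1 : Adm S b c) (h2 : Adm S c d) : LeftBijective φ (Adm S) b c d := by
  obtain ⟨s, hs, rfl, rfl, rfl⟩ := exists_mem_of_adm_adm hS h1 h2
  obtain ⟨h3, h4⟩ := hres _ _ _ (mem_words_three hs)
  have h5 : φ (s 0) (s 1) (s 2) ∈ symbols S := mem_symbols hS (hφ hs) 1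
  classical
  intro u
  exact ncard_fiber_eq h3 h4 (by rw [hP _ h5, hP _ (mem_symbols hS hs 0)]) u

lemma rightBijective_of_adm (hS : IsMarkovSubshift S) (hφ : Set.MapsTo (caMap φ) S S) {P : ℕ}
    (hP : ∀ b ∈ symbols S, (follow S b).ncard = P) (hres : RightResolving φ S) {b c d : A}
    (h1 : Adm S b c) (h2 : Adm S c d) :
    LeftBijective (fun a b c => φ c b a) (fun a b => Adm S b a) d c b := by
  obtain ⟨s, hs, rfl, rfl, rfl⟩ := exists_mem_of_adm_adm hS h1 h2
  obtain ⟨h3, h4⟩ := hres _ _ _ (mem_words_three hs)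
  have h5 : φ (s 0) (s 1) (s 2) ∈ symbols S := mem_symbols hS (hφ hs) 1
  classical
  intro u
  exact ncard_fiber_eq h3 h4 (by rw [hP _ h5, hP _ (mem_symbols hS hs 2)]) u

end Bijective

section MeasurableDynamics

variable {A : Type*} [Fintype A] [MeasurableSpace A] [MeasurableSingletonClass A]
  (φ : A → A → A → A) (L R S : Set (ℤ → A)) (W : ℕ)

lemma measurable_recentre : Measurable (recentre S) :=
  measurable_translate_comp (measurable_centre S) measurable_id

lemma measurable_followStep : Measurable (followStep φ S) := by
  have h : Measurable fun n : ℤ => n.sign := Measurable.of_discrete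
  exact measurable_translate_comp (h.comp ((measurable_centre S).comp (measurable_caMap φ)))
    (measurable_caMap φ)

lemma measurable_trajectory : Measurable (trajectory φ S) :=
  measurable_pi_lambda _ fun t => (measurable_centre S).comp ((measurable_caMap φ).iterate t)

lemma measurable_window_pattern (K : ℕ) : Measurable (window (A := A) K) :=
  measurable_pi_lambda _ fun _ => measurable_pi_apply _

lemma measurable_tameDefect : Measurable (TameDefect L R W : (ℤ → A) → Prop) := by
  have hm := measurable_mem_badSet (L ∪ R)
  have hc := measurable_centre (L ∪ R)
  refine Measurable.and (Measurable.exists fun i => Measurable.exists fun k => ?_)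
    (Measurable.and (Measurable.forall fun j => ?_) (Measurable.forall fun j => ?_))
  · refine Measurable.and ?_ (Measurable.and ?_ measurable_const)
    · exact (hm i).and (Measurable.forall fun j => (hm j).imp measurable_const)
    · exact (hm k).and (Measurable.forall fun j => (hm j).imp measurable_const)
  · have h : Measurable fun n : ℤ => j + 1 < n - extL W := Measurable.of_discrete
    exact (h.comp hc).imp (measurable_rel _ _ _)
  · have h : Measurable fun n : ℤ => n + extR W < j := Measurable.of_discrete
    exact (h.comp hc).imp (measurable_rel _ _ _)

lemma measurableSet_tracked : MeasurableSet (Tracked φ L R W) := by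
  have h1 : Measurable fun x : ℤ → A => ∀ t : ℕ, TameDefect L R W ((caMap φ)^[t] x) :=
    Measurable.forall fun t => (measurable_tameDefect L R W).comp ((measurable_caMap φ).iterate t)
  have h2 : Measurable fun x : ℤ → A =>
      ∀ j, j ∈ badSet (L ∪ R) x → -(extL W + 1) ≤ j ∧ j ≤ extR W :=
    Measurable.forall fun j => (measurable_mem_badSet _ j).imp measurable_const
  exact measurableSet_setOfPred.2 (h1.and h2)

end MeasurableDynamics

/-! ### Markov measures -/

lemma exists_factor {Ω X Y : Type*} [Nonempty Y] {T : Set Ω} {f : Ω → X} {g : Ω → Y}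
    (h : ∀ x ∈ T, ∀ y ∈ T, f x = f y → g x = g y) : ∃ v : X → Y, ∀ x ∈ T, g x = v (f x) := by
  classical
  refine ⟨fun c => if hc : ∃ x ∈ T, f x = c then g hc.choose else Classical.arbitrary Y,
    fun x hx => ?_⟩
  have hc : ∃ y ∈ T, f y = f x := ⟨x, hx, rfl⟩
  simp only [dif_pos hc]
  exact h x hx _ hc.choose_spec.1 hc.choose_spec.2.symm

lemma measurableSet_history {X : Type*} [MeasurableSpace X] [MeasurableSingletonClass X] (n : ℕ)
    (c : ℕ → X) : MeasurableSet {x : ℕ → X | ∀ i ≤ n, x i = c i} := by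
  rw [Set.ofPred_forall]
  refine MeasurableSet.iInter fun i => ?_
  rw [Set.ofPred_forall]
  refine MeasurableSet.iInter fun _ => ?_
  have h : MeasurableSet ((fun x : ℕ → X => x i) ⁻¹' {c i}) :=
    measurable_pi_apply i (measurableSet_singleton _)
  exact h

theorem isMarkovMeasure_of_transition {X : Type*} [Finite X] [MeasurableSpace X]
    [MeasurableSingletonClass X] (m : Measure (ℕ → X)) [IsProbabilityMeasure m]
    (κ : X → X → ENNReal) (h : ∀ (n : ℕ) (c : ℕ → X), m {x | ∀ i ≤ n + 1, x i = c i} =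
      κ (c n) (c (n + 1)) * m {x | ∀ i ≤ n, x i = c i}) : IsMarkovMeasure m := by
  classical
  have := Fintype.ofFinite X
  have hp : ∑ a, m ((fun x : ℕ → X => x 0) ⁻¹' {a}) = 1 := by
    have := measure_eq_sum_inter_fiber m (measurable_pi_apply 0) Set.univ
    rw [measure_univ] at this
    simpa using this.symm
  refine ⟨PMF.ofFintype _ hp, fun a => if ha : ∑ b, κ a b = 1 then PMF.ofFintype (κ a) ha
    else PMF.pure a, fun n c => ?_⟩
  induction n with
  | zero =>
    simp only [Finset.range_zero, Finset.prod_empty, mul_one, PMF.ofFintype_apply]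
    congr 1
    ext x
    simp
  | succ n ih =>
    rw [Finset.prod_range_succ, ← mul_assoc, ← ih, h]
    by_cases h0 : m {x | ∀ i ≤ n, x i = c i} = 0
    · rw [h0, mul_zero, zero_mul]
    have hsum : ∑ b, κ (c n) b = 1 := by
      have h1 := measure_eq_sum_inter_fiber m (measurable_pi_apply (n + 1))
        {x : ℕ → X | ∀ i ≤ n, x i = c i}
      have h2 : ∀ b, m ({x : ℕ → X | ∀ i ≤ n, x i = c i} ∩ (fun x : ℕ → X => x (n + 1)) ⁻¹' {b}) =
          κ (c n) b * m {x | ∀ i ≤ n, x i = c i} := by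
        intro b
        have h3 := h n (Function.update c (n + 1) b)
        have hu : ∀ i ≤ n, Function.update c (n + 1) b i = c i := fun i hi =>
          Function.update_of_ne (by omega) _ _
        rw [Function.update_self, hu n le_rfl] at h3
        have e1 : {x : ℕ → X | ∀ i ≤ n, x i = Function.update c (n + 1) b i} =
            {x | ∀ i ≤ n, x i = c i} := by
          ext x
          exact forall_congr' fun i => forall_congr' fun hi => by rw [hu i hi]
        have e2 : {x : ℕ → X | ∀ i ≤ n + 1, x i = Function.update c (n + 1) b i} =
            {x : ℕ → X | ∀ i ≤ n, x i = c i} ∩ (fun x : ℕ → X => x (n + 1)) ⁻¹' {b} := by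
          ext x
          constructor
          · intro hx
            refine ⟨fun i hi => ?_, ?_⟩
            · rw [hx i (by omega), hu i hi]
            · have := hx (n + 1) le_rfl
              rwa [Function.update_self] at this
          · rintro ⟨hx, hx1⟩ i hi
            rcases hi.eq_or_lt with rfl | hi
            · rw [Function.update_self]
              exact hx1
            · rw [hu i (by omega)]
              exact hx i (by omega)
        rw [e1, e2] at h3
        exact h3
      simp only [h2] at h1
      rw [← Finset.sum_mul] at h1
      have h4 := ENNReal.mul_left_inj h0 (measure_ne_top m _) |>.1
        (h1.symm.trans (one_mul _).symm)
      exact h4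
    simp only [dif_pos hsum, PMF.ofFintype_apply]
    rw [mul_comm]

lemma IsMarkovMeasure.map_equiv {X Y : Type*} [MeasurableSpace X] [MeasurableSpace Y]
    [MeasurableSingletonClass Y] {m : Measure (ℕ → X)} (hm : IsMarkovMeasure m) (e : X ≃ Y)
    (he : Measurable e) : IsMarkovMeasure (m.map fun x t => e (x t)) := by
  classical
  obtain ⟨p, τ, h⟩ := hm
  have hmap : ∀ (p : PMF X) (b : Y), p.map e b = p (e.symm b) := by
    intro p b
    rw [PMF.map_apply, tsum_eq_single (e.symm b)]
    · simp
    · intro a ha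
      rw [if_neg]
      rintro rfl
      simp at ha
  refine ⟨p.map e, fun b => (τ (e.symm b)).map e, fun n c => ?_⟩
  have hmeas : Measurable fun (x : ℕ → X) t => e (x t) :=
    measurable_pi_lambda _ fun t => he.comp (measurable_pi_apply t)
  rw [Measure.map_apply hmeas (measurableSet_history n c)]
  simp only [hmap]
  rw [← h n fun i => e.symm (c i)]
  congr 1
  ext x
  simp only [Set.mem_preimage, Set.mem_ofPred_eq]
  exact forall_congr' fun i => forall_congr' fun _ => (Equiv.eq_symm_apply e).symm

/-! ### The transition probabilities of the local state -/

section Transition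

variable {A : Type*}

/-- An extension of a finite pattern to a configuration. -/
def extend {K : ℕ} (w : Set.Icc (-(K : ℤ)) K → A) : ℤ → A := fun j =>
  if h : j ∈ Set.Icc (-(K : ℤ)) K then w ⟨j, h⟩ else w ⟨0, by simp⟩

lemma window_extend {K : ℕ} (w : Set.Icc (-(K : ℤ)) K → A) : window K (extend w) = w := by
  funext j
  simp [window, extend]

lemma window_preimage_singleton {K : ℕ} (x : ℤ → A) :
    window K ⁻¹' {window K x} = cyl x (-K) K := by
  ext y
  exact window_eq_iff

variable [Fintype A] [MeasurableSpace A] [MeasurableSingletonClass A]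

lemma measurableSet_window_preimage (K : ℕ) (c : Set.Icc (-(K : ℤ)) K → A) :
    MeasurableSet (window K ⁻¹' {c}) :=
  measurable_window_pattern K (measurableSet_singleton c)

/-- Measures that are uniform outside the window `[-K, K]`, on which they are concentrated on the
single pattern `c`. -/
structure WindowUniform (E : A → A → Prop) (P : ℕ) (E' : A → A → Prop) (F : ℕ) (K : ℕ)
    (T : Set (ℤ → A)) (c : Set.Icc (-(K : ℤ)) K → A) (ν : Measure (ℤ → A)) : Prop where
  left : LeftUniform E P ν (-K) K
  right : RightUniform E' F ν (-K) K
  carried : ∀ᵐ x ∂ν, x ∈ T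
  pattern : ∀ᵐ x ∂ν, window K x = c

theorem exists_transition (φ : A → A → A → A) (E E' : A → A → Prop) {P F : ℕ} (hP : P ≠ 0)
    (hF : F ≠ 0) {K : ℕ} (T : Set (ℤ → A)) (g : (Set.Icc (-(K : ℤ)) K → A) → ℤ) :
    ∃ κ : (Set.Icc (-(K : ℤ)) K → A) → (Set.Icc (-(K : ℤ)) K → A) → ENNReal,
      ∀ (c c' : Set.Icc (-(K : ℤ)) K → A) (ν : Measure (ℤ → A)),
        WindowUniform E P E' F K T c ν →
          ν {x | window K (translate (g c).sign (caMap φ x)) = c'} = κ c c' * ν Set.univ := by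
  classical
  let k : (ℤ → A) → Prop := fun e => E (e (-K - 2)) (e (-K - 1)) ∧ E (e (-K - 1)) (e (-K)) ∧
    E' (e K) (e (K + 1)) ∧ E' (e (K + 1)) (e (K + 2))
  refine ⟨fun c c' => ∑ w : Set.Icc (-((K + 2 : ℕ) : ℤ)) (K + 2 : ℕ) → A,
    if (window K (extend w) = c ∧ k (extend w)) ∧
      window K (translate (g c).sign (caMap φ (extend w))) = c' then
      ((P ^ 2 * F ^ 2 : ENNReal))⁻¹ else 0, fun c c' ν h => ?_⟩
  rw [measure_eq_sum_inter_fiber ν (measurable_window_pattern (K + 2)), Finset.sum_mul]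
  refine Finset.sum_congr rfl fun w _ => ?_
  set e := extend w with he
  have hfib : window (K + 2) ⁻¹' {w} = cyl e (-K - 2) (K + 2) := by
    rw [← window_extend w, window_preimage_singleton]
    congr 1 <;> (push_cast; ring)
  have hD0 : (P ^ 2 * F ^ 2 : ENNReal) ≠ 0 := by simp [hP, hF]
  have hDt : (P ^ 2 * F ^ 2 : ENNReal) ≠ ⊤ := by
    exact ENNReal.mul_ne_top (by simp) (by simp)
  have hcyl : ν (cyl e (-K) K) = if window K e = c then ν Set.univ else 0 := by
    rw [← window_preimage_singleton]
    split_ifs with h1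
    · refine measure_congr (h.pattern.mono fun x hx => propext ⟨fun _ => trivial, fun _ => ?_⟩)
      change window K x = window K e
      rw [hx, h1]
    · refine measure_eq_zero_iff_ae_notMem.2 (h.pattern.mono fun x hx hmem => h1 ?_)
      have h2 : window K x = window K e := hmem
      rw [← h2, hx]
  have hmass : ν (cyl e (-K - 2) (K + 2)) =
      if window K e = c ∧ k e then ((P ^ 2 * F ^ 2 : ENNReal))⁻¹ * ν Set.univ else 0 := by
    have h2 := measure_cyl_two_steps h.left h.right e
    rw [hcyl] at h2
    have h3 : ν (cyl e (-K - 2) (K + 2)) =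
        (if k e then 1 else 0) * (if window K e = c then ν Set.univ else 0) *
          (P ^ 2 * F ^ 2 : ENNReal)⁻¹ := by
      rw [← h2, mul_assoc, ENNReal.mul_inv_cancel hD0 hDt, mul_one]
    rw [h3]
    by_cases c1 : k e <;> by_cases c2 : window K e = c <;> simp [c1, c2, mul_comm]
  have hcong : ∀ x ∈ cyl e (-K - 2) (K + 2),
      window K (translate (g c).sign (caMap φ x)) =
        window K (translate (g c).sign (caMap φ e)) := by
    intro x hx
    rw [window_eq_iff]
    intro j h1 h2
    have h3 : (g c).sign = -1 ∨ (g c).sign = 0 ∨ (g c).sign = 1 := by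
      rcases lt_trichotomy (g c) 0 with h0 | h0 | h0
      · exact Or.inl (Int.sign_eq_neg_one_of_neg h0)
      · exact Or.inr (Or.inl (by rw [h0, Int.sign_zero]))
      · exact Or.inr (Or.inr (Int.sign_eq_one_of_pos h0))
    simp only [translate, caMap]
    rw [hx _ (by omega) (by omega), hx _ (by omega) (by omega), hx _ (by omega) (by omega)]
  rw [hfib]
  by_cases hc : window K (translate (g c).sign (caMap φ e)) = c'
  · have hset : {x | window K (translate (g c).sign (caMap φ x)) = c'} ∩
        cyl e (-K - 2) (K + 2) = cyl e (-K - 2) (K + 2) := by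
      refine Set.inter_eq_right.2 fun x hx => ?_
      exact (hcong x hx).trans hc
    rw [hset, hmass]
    simp only [hc, and_true]
    split_ifs <;> simp
  · have hset : {x | window K (translate (g c).sign (caMap φ x)) = c'} ∩
        cyl e (-K - 2) (K + 2) = ∅ := by
      refine Set.eq_empty_of_forall_notMem fun x hx => hc ?_
      rw [← hcong x hx.2]
      exact hx.1
    rw [hset]
    simp [hc]

lemma WindowUniform.map_step {φ : A → A → A → A} {E E' : A → A → Prop} {P F : ℕ} {K : ℕ}
    {T : Set (ℤ → A)} {c : Set.Icc (-(K : ℤ)) K → A} {ν : Measure (ℤ → A)}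
    (h : WindowUniform E P E' F K T c ν) (hK : 3 ≤ K) (hT : MeasurableSet T)
    {Ψ : (ℤ → A) → ℤ → A} (hΨ : Measurable Ψ) (hΨT : ∀ x ∈ T, Ψ x ∈ T)
    {g : (Set.Icc (-(K : ℤ)) K → A) → ℤ}
    (hg : ∀ x ∈ T, Ψ x = translate (g (window K x)).sign (caMap φ x))
    (hl : ∀ x ∈ T, ∀ j ≤ -(K : ℤ), LeftBijective φ E (x j) (x (j + 1)) (x (j + 2)))
    (hr : ∀ x ∈ T, ∀ j ≥ (K : ℤ), LeftBijective (fun a b c => φ c b a) (fun a b => E' b a)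
      (x j) (x (j - 1)) (x (j - 2))) (c' : Set.Icc (-(K : ℤ)) K → A) :
    WindowUniform E P E' F K T c' ((ν.map Ψ).restrict (window K ⁻¹' {c'})) := by
  have hmap : ν.map Ψ = (ν.map (caMap φ)).map (translate (g c).sign) := by
    rw [Measure.map_map (measurable_translate _) (measurable_caMap φ)]
    refine Measure.map_congr ?_
    filter_upwards [h.carried, h.pattern] with x h1 h2
    rw [hg x h1, h2]
    rfl
  have hs : -1 ≤ (g c).sign ∧ (g c).sign ≤ 1 := by
    rcases lt_trichotomy (g c) 0 with h0 | h0 | h0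
    · rw [Int.sign_eq_neg_one_of_neg h0]; omega
    · rw [h0, Int.sign_zero]; omega
    · rw [Int.sign_eq_one_of_pos h0]; omega
  have hcar : ∀ᵐ x ∂(ν.map Ψ), x ∈ T :=
    (ae_map_iff hΨ.aemeasurable hT).2 (h.carried.mono hΨT)
  have hL : LeftUniform E P (ν.map Ψ) (-K) K := by
    rw [hmap]
    exact ((h.left.map_caMap (by omega) (h.carried.mono hl)).translate _).mono
      (by omega) (by omega)
  have hR : RightUniform E' F (ν.map Ψ) (-K) K := by
    rw [hmap]
    exact ((h.right.map_caMap (by omega) (h.carried.mono hr)).translate _).mono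
      (by omega) (by omega)
  have hw : ∀ x ∈ (Set.univ : Set (ℤ → A)), ∀ y ∈ (Set.univ : Set (ℤ → A)),
      (∀ j, -(K : ℤ) ≤ j → j ≤ K → x j = y j) → x ∈ window K ⁻¹' {c'} → y ∈ window K ⁻¹' {c'} :=
    fun x _ y _ hxy hx => (window_eq_iff.2 hxy).symm.trans hx
  have hu : ∀ᵐ x ∂(ν.map Ψ), x ∈ (Set.univ : Set (ℤ → A)) := Filter.Eventually.of_forall fun _ =>
    Set.mem_univ _
  exact
    { left := hL.restrict hu hw
      right := hR.restrict (measurableSet_window_preimage K c') MeasurableSet.univ hu hw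
      carried := ae_restrict_of_ae hcar
      pattern := ae_restrict_mem (measurableSet_window_preimage K c') }

/-- The law of the successive windows of a dynamical system that preserves uniformity outside of
the window is a Markov measure. -/
theorem isMarkovMeasure_windows {φ : A → A → A → A} {E E' : A → A → Prop} {P F : ℕ} (hP : P ≠ 0)
    (hF : F ≠ 0) {K : ℕ} (hK : 3 ≤ K) {T : Set (ℤ → A)} (hT : MeasurableSet T)
    {Ψ : (ℤ → A) → ℤ → A} (hΨ : Measurable Ψ) (hΨT : ∀ x ∈ T, Ψ x ∈ T)
    {g : (Set.Icc (-(K : ℤ)) K → A) → ℤ}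
    (hg : ∀ x ∈ T, Ψ x = translate (g (window K x)).sign (caMap φ x))
    (hl : ∀ x ∈ T, ∀ j ≤ -(K : ℤ), LeftBijective φ E (x j) (x (j + 1)) (x (j + 2)))
    (hr : ∀ x ∈ T, ∀ j ≥ (K : ℤ), LeftBijective (fun a b c => φ c b a) (fun a b => E' b a)
      (x j) (x (j - 1)) (x (j - 2))) {ν : Measure (ℤ → A)} [IsProbabilityMeasure ν]
    (hνT : ∀ᵐ x ∂ν, x ∈ T) (hνl : LeftUniform E P ν (-K) K) (hνr : RightUniform E' F ν (-K) K) :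
    IsMarkovMeasure (ν.map fun x t => window K (Ψ^[t] x)) := by
  obtain ⟨κ, hκ⟩ := exists_transition φ E E' hP hF T g
  have hproc : Measurable fun (x : ℤ → A) (t : ℕ) => window K (Ψ^[t] x) :=
    measurable_pi_lambda _ fun t => (measurable_window_pattern K).comp (hΨ.iterate t)
  have := Measure.isProbabilityMeasure_map (μ := ν) hproc.aemeasurable
  let H : ℕ → (ℕ → Set.Icc (-(K : ℤ)) K → A) → Set (ℤ → A) := fun n c =>
    {x | ∀ i ≤ n, window K (Ψ^[i] x) = c i}
  have hHm : ∀ n c, MeasurableSet (H n c) := fun n c => hproc (measurableSet_history n c)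
  have hHs : ∀ n c, H (n + 1) c = H n c ∩ Ψ^[n + 1] ⁻¹' (window K ⁻¹' {c (n + 1)}) := by
    intro n c
    ext x
    constructor
    · exact fun hx => ⟨fun i hi => hx i (by omega), hx (n + 1) le_rfl⟩
    · rintro ⟨h1, h2⟩ i hi
      rcases hi.eq_or_lt with rfl | hi
      · exact h2
      · exact h1 i (by omega)
  let M : ℕ → (ℕ → Set.Icc (-(K : ℤ)) K → A) → Measure (ℤ → A) := fun n c =>
    (ν.restrict (H n c)).map Ψ^[n]
  have hMs : ∀ n c, M (n + 1) c = ((M n c).map Ψ).restrict (window K ⁻¹' {c (n + 1)}) := by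
    intro n c
    simp only [M]
    rw [Measure.map_map hΨ (hΨ.iterate n), ← Function.iterate_succ',
      Measure.restrict_map (hΨ.iterate _) (measurableSet_window_preimage K _),
      Measure.restrict_restrict (hΨ.iterate _ (measurableSet_window_preimage K _)), hHs,
      Set.inter_comm]
  have hMu : ∀ n c, M n c Set.univ = ν (H n c) := by
    intro n c
    simp only [M]
    rw [Measure.map_apply (hΨ.iterate n) MeasurableSet.univ, Set.preimage_univ,
      Measure.restrict_apply_univ]
  have hM : ∀ n c, WindowUniform E P E' F K T (c n) (M n c) := by
    intro n c
    induction n with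
    | zero =>
      have h0 : H 0 c = window K ⁻¹' {c 0} := by
        ext x
        simp [H]
      have hM0 : M 0 c = ν.restrict (window K ⁻¹' {c 0}) := by
        simp only [M]
        rw [h0, Function.iterate_zero, Measure.map_id]
      rw [hM0]
      have hw : ∀ x ∈ (Set.univ : Set (ℤ → A)), ∀ y ∈ (Set.univ : Set (ℤ → A)),
          (∀ j, -(K : ℤ) ≤ j → j ≤ K → x j = y j) → x ∈ window K ⁻¹' {c 0} →
            y ∈ window K ⁻¹' {c 0} :=
        fun x _ y _ hxy hx => (window_eq_iff.2 hxy).symm.trans hx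
      have hu : ∀ᵐ x ∂ν, x ∈ (Set.univ : Set (ℤ → A)) :=
        Filter.Eventually.of_forall fun _ => Set.mem_univ _
      exact
        { left := hνl.restrict hu hw
          right := hνr.restrict (measurableSet_window_preimage K _) MeasurableSet.univ hu hw
          carried := ae_restrict_of_ae hνT
          pattern := ae_restrict_mem (measurableSet_window_preimage K _) }
    | succ n ih =>
      rw [hMs]
      exact ih.map_step hK hT hΨ hΨT hg hl hr _
  refine isMarkovMeasure_of_transition _ κ fun n c => ?_
  rw [Measure.map_apply hproc (measurableSet_history _ _),
    Measure.map_apply hproc (measurableSet_history _ _)]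
  change ν (H (n + 1) c) = _ * ν (H n c)
  rw [← hMu, ← hMu, hMs, Measure.restrict_apply_univ,
    Measure.map_apply hΨ (measurableSet_window_preimage K _), ← hκ _ _ _ (hM n c)]
  refine measure_congr ?_
  filter_upwards [(hM n c).carried, (hM n c).pattern] with x h1 h2
  have h3 := hg x h1
  rw [h2] at h3
  change (window K (Ψ x) = c (n + 1)) = (window K _ = c (n + 1))
  rw [h3]

end Transition

/-! ### The law of the recentred initial configuration -/

section Recentred

variable {A : Type*} [Fintype A] [MeasurableSpace A] [MeasurableSingletonClass A]
  {φ : A → A → A → A} {L R : Set (ℤ → A)} {lam rho : Measure (ℤ → A)} {W : ℕ}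

lemma Adm.mono {S S' : Set (ℤ → A)} (h : S ⊆ S') {a b : A} (hab : Adm S a b) : Adm S' a b := by
  obtain ⟨s, hs, hi⟩ := hab
  exact ⟨s, h hs, hi⟩

lemma ae_badSet_initialMeasure {del : Measure (Fin W → A)} [IsProbabilityMeasure lam]
    [IsProbabilityMeasure rho] [IsProbabilityMeasure del] (hL : IsMarkovSubshift L)
    (hR : IsMarkovSubshift R) (hlam : ∀ᵐ x ∂lam, x ∈ L) (hrho : ∀ᵐ x ∂rho, x ∈ R) :
    ∀ᵐ a ∂(initialMeasure W lam del rho),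
      ∀ j ∈ badSet (L ∪ R) a, -(extL W + 1) ≤ j ∧ j ≤ extR W := by
  have hm : MeasurableSet {a : ℤ → A | ∀ j ∈ badSet (L ∪ R) a, -(extL W + 1) ≤ j ∧ j ≤ extR W} :=
    measurableSet_setOfPred.2
      (Measurable.forall fun j => (measurable_mem_badSet _ j).imp measurable_const)
  rw [initialMeasure, ae_map_iff (measurable_glue W).aemeasurable hm]
  have h1 : ∀ᵐ y ∂(lam.prod (del.prod rho)), y.1 ∈ L :=
    Measure.quasiMeasurePreserving_fst.ae hlam
  have h2 : ∀ᵐ y ∂(lam.prod (del.prod rho)), y.2.2 ∈ R :=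
    Measure.quasiMeasurePreserving_snd.ae (Measure.quasiMeasurePreserving_snd.ae hrho)
  filter_upwards [h1, h2] with y hl hr j hj
  by_contra hne
  refine hj ?_
  unfold glue
  have hW : extL W + extR W + 1 = W := by unfold extL extR; omega
  rcases (show j < -(extL W + 1) ∨ extR W < j by omega) with h | h
  · rw [dif_pos (by omega), dif_pos (by omega)]
    have := (hL.adm hl (j + extL W)).mono (Set.subset_union_left (t := R))
    rwa [add_right_comm] at this
  · rw [dif_neg (by omega), dif_pos (by omega), dif_neg (by omega), dif_pos (by omega)]
    have := (hR.adm hr (j - extR W)).mono (Set.subset_union_right (s := L))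
    rwa [sub_add_eq_add_sub] at this

lemma Tracked.centre_mem {x : ℤ → A} (h : x ∈ Tracked φ L R W) :
    -(extL W + 1) ≤ centre (L ∪ R) x ∧ centre (L ∪ R) x ≤ extR W := by
  obtain ⟨ht, hb⟩ := h
  obtain ⟨⟨i, k, hi, hk, -⟩, -⟩ := ht 0
  rw [Function.iterate_zero, id] at *
  have h1 := hb i hi.1
  have h2 := hb k hk.1
  have h3 := hk.2 hi.1
  rw [centre_eq hi hk]
  omega

lemma map_recentre_eq_sum (μ : Measure (ℤ → A)) (S : Set (ℤ → A)) :
    μ.map (recentre S) =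
      Measure.sum fun n : ℤ => (μ.restrict (centre S ⁻¹' {n})).map (translate n) := by
  have hc : ∀ n : ℤ, MeasurableSet (centre S ⁻¹' {n}) := fun n =>
    measurable_centre S (measurableSet_singleton n)
  have h1 : μ = Measure.sum fun n : ℤ => μ.restrict (centre S ⁻¹' {n}) := by
    rw [← Measure.restrict_iUnion _ hc]
    · rw [← Set.preimage_iUnion, Set.iUnion_of_singleton, Set.preimage_univ,
        Measure.restrict_univ]
    · intro m n hmn
      exact Disjoint.preimage _ (by simpa using hmn)
  conv_lhs => rw [h1]
  rw [Measure.map_sum (measurable_recentre S).aemeasurable]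
  congr 1
  funext n
  refine Measure.map_congr ?_
  filter_upwards [ae_restrict_mem (hc n)] with x hx
  have : centre S x = n := hx
  rw [recentre, this]

lemma restrict_centre_eq_zero {μ : Measure (ℤ → A)} (hμ : ∀ᵐ x ∂μ, x ∈ Tracked φ L R W) {n : ℤ}
    (hn : ¬ (-(extL W + 1) ≤ n ∧ n ≤ extR W)) : μ.restrict (centre (L ∪ R) ⁻¹' {n}) = 0 := by
  rw [Measure.restrict_eq_zero]
  refine measure_eq_zero_iff_ae_notMem.2 (hμ.mono fun x hx hmem => hn ?_)
  have h : centre (L ∪ R) x = n := hmem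
  rw [← h]
  exact Tracked.centre_mem hx

lemma centre_preimage_of_agree (n : ℤ) : ∀ x ∈ Tracked φ L R W, ∀ y ∈ Tracked φ L R W,
    (∀ j, -extL W - 1 ≤ j → j ≤ extR W + 1 → x j = y j) →
      x ∈ centre (L ∪ R) ⁻¹' {n} → y ∈ centre (L ∪ R) ⁻¹' {n} := by
  intro x hx y hy hxy hxn
  have h : centre (L ∪ R) x = centre (L ∪ R) y := by
    refine centre_eq_of_agree (p := -extL W - 1) (q := extR W + 1) (fun j hj => ?_)
      (fun j hj => ?_) hxy
    · have := hx.2 j hj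
      omega
    · have := hy.2 j hj
      omega
  exact h.symm.trans hxn

lemma leftUniform_map_recentre {E : A → A → Prop} {P : ℕ} {μ : Measure (ℤ → A)}
    (hμ : ∀ᵐ x ∂μ, x ∈ Tracked φ L R W) (h : LeftUniform E P μ (-extL W - 1) (extR W + 1)) {K : ℕ}
    (hK : W + 3 ≤ K) : LeftUniform E P (μ.map (recentre (L ∪ R))) (-K) K := by
  rw [map_recentre_eq_sum]
  refine LeftUniform.sum fun n => ?_
  by_cases hn : -(extL W + 1) ≤ n ∧ n ≤ extR W
  · refine ((h.restrict hμ (centre_preimage_of_agree n)).translate n).mono ?_ ?_ <;>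
      unfold extL extR at * <;> omega
  · rw [restrict_centre_eq_zero hμ hn, Measure.map_zero]
    intro p _ q _ c
    simp

lemma rightUniform_map_recentre {E : A → A → Prop} {P : ℕ} {μ : Measure (ℤ → A)}
    (hμ : ∀ᵐ x ∂μ, x ∈ Tracked φ L R W) (h : RightUniform E P μ (-extL W - 1) (extR W + 1))
    {K : ℕ} (hK : W + 3 ≤ K) : RightUniform E P (μ.map (recentre (L ∪ R))) (-K) K := by
  rw [map_recentre_eq_sum]
  refine RightUniform.sum fun n => ?_
  by_cases hn : -(extL W + 1) ≤ n ∧ n ≤ extR W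
  · refine ((h.restrict (measurable_centre _ (measurableSet_singleton n))
      (measurableSet_tracked φ L R W) hμ (centre_preimage_of_agree n)).translate n).mono ?_ ?_ <;>
      unfold extL extR at * <;> omega
  · rw [restrict_centre_eq_zero hμ hn, Measure.map_zero, rightUniform_iff]
    intro p _ q _ c
    simp

end Recentred

/-! ### The local state of the particle -/

section Main

variable {A : Type*} [Fintype A] [MeasurableSpace A] [MeasurableSingletonClass A]
  {φ : A → A → A → A} {L R : Set (ℤ → A)} {lam rho : Measure (ℤ → A)} {W : ℕ}
  {del : Measure (Fin W → A)}

theorem ae_tracked (hsys : IsResolvingSystem φ L R lam rho) [IsProbabilityMeasure del]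
    (hpart : ∀ᵐ a ∂(initialMeasure W lam del rho), a ∈ particles φ L R W) :
    ∀ᵐ a ∂(initialMeasure W lam del rho), a ∈ Tracked φ L R W := by
  have := hsys.left_parry.prob
  have := hsys.right_parry.prob
  filter_upwards [hpart, ae_badSet_initialMeasure hsys.markov_left hsys.markov_right
    hsys.left_parry.carried hsys.right_parry.carried] with a h1 h2
  exact ⟨particles_subset_tame hsys.markov_left hsys.markov_right h1, h2⟩

theorem isMarkovMeasure_localState (hsys : IsResolvingSystem φ L R lam rho)
    [IsProbabilityMeasure del]
    (hpart : ∀ᵐ a ∂(initialMeasure W lam del rho), a ∈ particles φ L R W) {K : ℕ}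
    (hK : W + 3 ≤ K) :
    IsMarkovMeasure ((initialMeasure W lam del rho).map (localState φ (L ∪ R) K)) := by
  have := hsys.left_parry.prob
  have := hsys.right_parry.prob
  obtain ⟨P, hPreg⟩ := hsys.left_regular
  obtain ⟨F, hFreg⟩ := hsys.right_regular
  obtain ⟨hP, hlam⟩ := hsys.left_parry.leftUniform hsys.markov_left hPreg (le_refl (-1))
  obtain ⟨hF, hrho⟩ := hsys.right_parry.rightUniform hsys.markov_right hFreg (le_refl 1)
  have htr := ae_tracked hsys hpart
  set μ := initialMeasure W lam del rho with hμ
  have : IsProbabilityMeasure μ :=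
    Measure.isProbabilityMeasure_map (measurable_glue W).aemeasurable
  have hφ := mapsTo_union hsys.left_invariant hsys.right_invariant
  have hrm := measurable_recentre (A := A) (L ∪ R)
  obtain ⟨g, hg⟩ := exists_factor (T := Tracked φ L R W) (f := window K)
    (g := fun x => centre (L ∪ R) (caMap φ x)) fun x hx y hy hxy =>
      centre_caMap_eq_of_window hsys.markov_union hφ hK hx hy hxy
  have := Measure.isProbabilityMeasure_map (μ := μ) hrm.aemeasurable
  have key := isMarkovMeasure_windows (φ := φ) (E := Adm L) (E' := Adm R) hP hF
    (show 3 ≤ K by omega) (measurableSet_tracked φ L R W) (measurable_followStep φ (L ∪ R))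
    (fun x hx => followStep_mem_tracked hsys.markov_union hφ hx) (g := g)
    (fun x hx => by rw [followStep, ← hg x hx])
    (fun x hx j hj => by
      have h1 := Tracked.adm_left hK hx (j := j) (by omega)
      have h2 := Tracked.adm_left hK hx (j := j + 1) (by omega)
      rw [show j + 1 + 1 = j + 2 by ring] at h2
      exact leftBijective_of_adm hsys.markov_left hsys.left_invariant hPreg hsys.left_resolving
        h1 h2)
    (fun x hx j hj => by
      have h1 := Tracked.adm_right hK hx (j := j - 2) (by omega)
      have h2 := Tracked.adm_right hK hx (j := j - 1) (by omega)
      rw [show j - 2 + 1 = j - 1 by ring] at h1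
      rw [show j - 1 + 1 = j by ring] at h2
      exact rightBijective_of_adm hsys.markov_right hsys.right_invariant hFreg
        hsys.right_resolving h1 h2)
    (ν := μ.map (recentre (L ∪ R)))
    ((ae_map_iff hrm.aemeasurable (measurableSet_tracked φ L R W)).2
      (htr.mono fun x hx => recentre_mem_tracked hx.1))
    (leftUniform_map_recentre htr (leftUniform_initialMeasure hlam) hK)
    (rightUniform_map_recentre htr (rightUniform_initialMeasure hrho) hK)
  have hproc : Measurable fun (x : ℤ → A) (t : ℕ) =>
      window K ((followStep φ (L ∪ R))^[t] x) :=
    measurable_pi_lambda _ fun t =>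
      (measurable_window_pattern K).comp ((measurable_followStep φ (L ∪ R)).iterate t)
  rw [Measure.map_map hproc hrm] at key
  convert key using 1
  refine Measure.map_congr (htr.mono fun x hx => ?_)
  funext t
  exact localState_eq hx.1 K t

theorem exists_increment (hsys : IsResolvingSystem φ L R lam rho) {K : ℕ} (hK : W + 3 ≤ K) :
    ∃ v : (Set.Icc (-(K : ℤ)) K → A) → ℤ, ∀ a ∈ Tame φ L R W, ∀ t : ℕ,
      trajectory φ (L ∪ R) a (t + 1) =
        trajectory φ (L ∪ R) a t + v (localState φ (L ∪ R) K a t) := by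
  have hφ := mapsTo_union hsys.left_invariant hsys.right_invariant
  obtain ⟨v, hv⟩ := exists_factor (T := Tracked φ L R W) (f := window K)
    (g := fun x => centre (L ∪ R) (caMap φ x) - centre (L ∪ R) x) fun x hx y hy hxy => by
      rw [centre_caMap_eq_of_window hsys.markov_union hφ hK hx hy hxy,
        centre_eq_of_window hK hx hy hxy]
  refine ⟨v, fun a ha t => ?_⟩
  have hmem : ∀ t, (followStep φ (L ∪ R))^[t] (recentre (L ∪ R) a) ∈ Tracked φ L R W := by
    intro t
    induction t with
    | zero => exact recentre_mem_tracked ha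
    | succ t ih =>
      rw [Function.iterate_succ_apply']
      exact followStep_mem_tracked hsys.markov_union hφ ih
  rw [trajectory_succ_sub ha, localState_eq ha, ← hv _ (hmem t)]

lemma measurable_partialSums : Measurable partialSums :=
  measurable_pi_lambda _ fun _ => Finset.measurable_fun_sum _ fun _ _ => measurable_pi_apply _

lemma isHiddenMarkov_of_isMarkovMeasure {Ω X : Type*} [MeasurableSpace Ω] [Finite X]
    [MeasurableSpace X] [MeasurableSingletonClass X] {μ : Measure Ω} {ξ : Ω → ℕ → X}
    (hξ : Measurable ξ) (h : IsMarkovMeasure (μ.map ξ)) (v : X → ℤ) :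
    IsHiddenMarkov (μ.map fun a t => v (ξ a t)) := by
  obtain ⟨n, ⟨e⟩⟩ := Finite.exists_equiv_fin X
  have he : Measurable e := Measurable.of_discrete
  have hem : Measurable fun (x : ℕ → X) t => e (x t) :=
    measurable_pi_lambda _ fun t => he.comp (measurable_pi_apply t)
  have hvm : Measurable fun (x : ℕ → Fin n) t => v (e.symm (x t)) :=
    measurable_pi_lambda _ fun t =>
      (Measurable.of_discrete (f := fun i => v (e.symm i))).comp (measurable_pi_apply t)
  refine ⟨n, _, fun i => v (e.symm i), h.map_equiv e he, ?_⟩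
  rw [Measure.map_map hem hξ, Measure.map_map hvm (hem.comp hξ)]
  congr 1
  funext a t
  simp

lemma measurable_localState (S : Set (ℤ → A)) (K : ℕ) : Measurable (localState φ S K) := by
  have hf : ∀ t, Measurable fun a : ℤ → A => follower (trajectory φ S a) t := by
    intro t
    have hz : ∀ t, Measurable fun a : ℤ → A => trajectory φ S a t := fun t =>
      (measurable_pi_apply t).comp (measurable_trajectory φ S)
    induction t with
    | zero => exact hz 0
    | succ t ih =>
      have hs : Measurable fun n : ℤ => n.sign := Measurable.of_discrete
      exact ih.add (hs.comp ((hz (t + 1)).sub ih))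
  refine measurable_pi_lambda _ fun t => measurable_pi_lambda _ fun j => ?_
  have h := (measurable_pi_apply (j : ℤ)).comp
    (measurable_translate_comp (hf t) ((measurable_caMap φ).iterate t))
  convert h using 1
  funext a
  simp only [localState, Function.comp, translate, add_comm]

theorem isRandomWalk_displacement (hsys : IsResolvingSystem φ L R lam rho)
    [IsProbabilityMeasure del]
    (hpart : ∀ᵐ a ∂(initialMeasure W lam del rho), a ∈ particles φ L R W) :
    IsRandomWalk ((initialMeasure W lam del rho).map fun a t =>
      trajectory φ (L ∪ R) a t - trajectory φ (L ∪ R) a 0) := by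
  obtain ⟨v, hv⟩ := exists_increment (W := W) hsys (le_refl (W + 3))
  have hξ := measurable_localState (φ := φ) (L ∪ R) (W + 3)
  refine ⟨_, isHiddenMarkov_of_isMarkovMeasure hξ
    (isMarkovMeasure_localState hsys hpart le_rfl) v, ?_⟩
  have hvξ : Measurable fun (a : ℤ → A) (t : ℕ) => v (localState φ (L ∪ R) (W + 3) a t) :=
    measurable_pi_lambda _ fun t =>
      (Measurable.of_discrete (f := v)).comp ((measurable_pi_apply t).comp hξ)
  rw [Measure.map_map measurable_partialSums hvξ]
  refine Measure.map_congr ((ae_tracked hsys hpart).mono fun a ha => ?_)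
  funext t
  simp only [Function.comp, partialSums]
  induction t with
  | zero => simp
  | succ t ih =>
    rw [Finset.sum_range_succ, ← ih, hv a ha.1 t]
    ring

end Main

end

end DefectCA

theorem theorem3p1 {A : Type*} [Fintype A] [MeasurableSpace A] [MeasurableSingletonClass A]
    (φ : A → A → A → A) (L R : Set (ℤ → A)) (lam rho : Measure (ℤ → A))
    (hsys : DefectCA.IsResolvingSystem φ L R lam rho)
    (W : ℕ) (del : Measure (Fin W → A)) (hdel : IsProbabilityMeasure del)
    (μ : Measure (ℤ → A)) (hμ : μ = DefectCA.initialMeasure W lam del rho)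
    (hpart : ∀ᵐ a ∂μ, a ∈ DefectCA.particles φ L R W) :
    ((∀ᵐ a ∂μ, DefectCA.trajectory φ (L ∪ R) a 0 = 0) →
        DefectCA.IsRandomWalk (μ.map (DefectCA.trajectory φ (L ∪ R)))) ∧
      DefectCA.IsRandomWalk (μ.map fun a t =>
        DefectCA.trajectory φ (L ∪ R) a t - DefectCA.trajectory φ (L ∪ R) a 0) ∧
      ∀ K : ℕ, W + 3 ≤ K →
        DefectCA.IsMarkovMeasure (μ.map (DefectCA.localState φ (L ∪ R) K)) ∧
          ∃ v : (Set.Icc (-(K : ℤ)) K → A) → ℤ, ∀ᵐ a ∂μ, ∀ t : ℕ,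
            DefectCA.trajectory φ (L ∪ R) a (t + 1) =
              DefectCA.trajectory φ (L ∪ R) a t + v (DefectCA.localState φ (L ∪ R) K a t) := by
  subst hμ
  have hwalk := DefectCA.isRandomWalk_displacement hsys hpart
  refine ⟨fun h0 => ?_, hwalk, fun K hK =>
    ⟨DefectCA.isMarkovMeasure_localState hsys hpart hK, ?_⟩⟩
  · convert hwalk using 1
    refine Measure.map_congr (h0.mono fun a ha => ?_)
    funext t
    simp only [ha, sub_zero]
  · obtain ⟨v, hv⟩ := DefectCA.exists_increment (W := W) hsys hK
    exact ⟨v, (DefectCA.ae_tracked hsys hpart).mono fun a ha => hv a ha.1⟩
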